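/- Let $\hat f(\xi)=\int_{\mathbb R}e^{-ix\xi}f(x)\,dx$ denote the Fourier transform, extended to $L^2(\mathbb R)$, and for $s\ge 0$ let $H^s(\mathbb R)$ be the space of complex-valued $f\in L^2(\mathbb R)$ with $\int_{\mathbb R}(1+|\xi|^2)^s|\hat f(\xi)|^2\,d\xi<\infty$. For $f\in L^2(\mathbb R)$ and $t,x\in\mathbb R$ the one-dimensional Boussinesq operator is $$\mathcal B_tf(x)=\frac1{2\pi}\int_{\mathbb R}e^{ix\xi}\,e^{it|\xi|\sqrt{1+|\xi|^2}}\,\hat f(\xi)\,d\xi ,$$ where the integral is understood as the improper integral $\lim_{R\to\infty}\int_{-R}^{R}$ wherever this limit exists (it is the ordinary integral when $\hat f$ is integrable). **Theorem 1.1.** The critical Sobolev index for the almost everywhere convergence of $\mathcal B_tf$ to $f$ is $\tfrac14$: this is the least $\sigma\ge 0$ such that the conclusion of (i) holds for all $s\ge\sigma$ and all $f\in H^s(\mathbb R)$. More precisely: (i) If $s\ge\frac14$ and $f\in H^s(\mathbb R)$, then for almost every $x\in\mathbb R$ the value $\mathcal B_tf(x)$ exists for all $t\in\mathbb R$, and $\lim_{t\to0}\mathcal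 B_tf(x)=f(x)$. (ii) If $0<s<\frac14$, there are disjoint compact intervals $I,J\subset\mathbb R$ of positive length and a function $f_0\in H^s(\mathbb R)$ supported in $I$ such that for every $x\in J$ the value $\mathcal B_tf_0(x)$ exists for all $t\in\mathbb R$, but $\mathcal B_tf_0(x)$ does not tend to $0$ as $t\to0^+$ (and hence not as $t\to0$). -/

import Mathlib

open MeasureTheory Filter Topology Set
open scoped FourierTransform SchwartzMap ENNReal

noncomputable section

/-- The Fourier transform `f̂(ξ) = ∫ e^{-ixξ} f(x) dx` of `f ∈ L²(ℝ)` (extended from Schwartz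
functions by continuity). Mathlib's `𝓕` has the kernel `e^{-2πixw}`, so that
`f̂(ξ) = (𝓕 f)(ξ / 2π)`. -/
def angularFourier (f : Lp ℂ 2 (volume : Measure ℝ)) (ξ : ℝ) : ℂ :=
  (𝓕 f : Lp ℂ 2 (volume : Measure ℝ)) (ξ / (2 * Real.pi))

/-- The partial integral over `|ξ| ≤ R` of the integral that defines the Boussinesq operator. -/
def boussinesqPartial (f : Lp ℂ 2 (volume : Measure ℝ)) (R t x : ℝ) : ℂ :=
  (2 * (Real.pi : ℂ))⁻¹ * ∫ ξ in (-R)..R,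
    Complex.exp (Complex.I * ((x * ξ : ℝ) : ℂ)) *
      Complex.exp (Complex.I * ((t * (|ξ| * √(1 + |ξ| ^ 2)) : ℝ) : ℂ)) * angularFourier f ξ

/-- The integral defining `B_t f(x)` converges, as an improper integral at `|ξ| = ∞`. -/
def BoussinesqExists (f : Lp ℂ 2 (volume : Measure ℝ)) (t x : ℝ) : Prop :=
  ∃ z : ℂ, Tendsto (fun R : ℝ => boussinesqPartial f R t x) atTop (𝓝 z)

/-- The Boussinesq operator
`B_t f(x) = (2π)⁻¹ ∫ e^{ixξ} e^{it|ξ|√(1+|ξ|²)} f̂(ξ) dξ`, an absolutely convergent integral if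
`f̂` is integrable (for instance for Schwartz functions `f`), and understood as the improper
integral `lim_{R → ∞} ∫_{|ξ| ≤ R}` for general `f`. It is meaningful where `BoussinesqExists`
holds, which all assertions about its values are to include. -/
def boussinesq (f : Lp ℂ 2 (volume : Measure ℝ)) (t x : ℝ) : ℂ :=
  limUnder atTop (fun R : ℝ => boussinesqPartial f R t x)

/-- The class in `L²(ℝ)` belongs to the Sobolev space `H^s(ℝ)`. For `s ≥ 0` every element of
`H^s(ℝ)` is such a class. -/
def MemHs (s : ℝ) (f : Lp ℂ 2 (volume : Measure ℝ)) : Prop :=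
  TemperedDistribution.MemSobolev s 2 (f : 𝓢'(ℝ, ℂ))

/-- For almost every `x`, the value `B_t f(x)` exists for all times `t` and tends to `f(x)` as
`t → 0`. -/
def BoussinesqConvergesAE (f : Lp ℂ 2 (volume : Measure ℝ)) : Prop :=
  ∀ᵐ x : ℝ, (∀ t : ℝ, BoussinesqExists f t x) ∧
    Tendsto (fun t : ℝ => boussinesq f t x) (𝓝[≠] 0) (𝓝 (f x))

end

/-! Write ω for the dispersion relation. For ξ ≥ 1 its second derivative lies in [1, 3], so
oscillatory integrals with phase xξ + tω(ξ) behave like those of the Schrödinger equation.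

Convergence for s ≥ 1/4 follows from the Kolmogorov–Seliverstov–Plessner method. Choose a time T(x)
and a frequency cutoff R(x) measurably; the resulting linear operator is treated by TT*. Its kernel
is a truncated integral of e^{i((x-y)ξ + (T(x)-T(y))ω(ξ))} ξ^{-1/2}, and van der Corput bounds it by
a multiple of |x-y|^{-1/2}, whatever the times and cutoffs (`norm_integral_maximal_kernel_le`). This
is locally integrable, so the linearized operator maps the weight √ξ into L¹ of bounded sets
(`integral_norm_linearized_le`), and Chebyshev gives a weak type maximal bound
(`volume_maximal_gt_le`). Since the cutoff is part of the supremum, applying the bound to frequency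
tails shows that for almost every x the partial integrals converge uniformly in t
(`ae_uniform_small_tail`). Hence all values exist and depend continuously on t, and the value at t =
0 is f(x) by L² inversion along a subsequence. No dense class is needed.

For s < 1/4 the counterexample is a sum of wave packets of width v and frequency v⁻². Such a packet
has H^s norm of order v^{(1-4s)/2}, travels left a distance |x| in a time of order v²|x|, and has
barely dispersed on arrival if |x| is small (`IsPacket.one_sub_le_norm_evolution`). With widths
satisfying v_{j+1} = v_j⁴, at the arrival time of packet k the wider packets have hardly moved
(`IsPacket.norm_evolution_le_of_eq_zero`) and the narrower ones are small by the |t|^{-1/2}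
dispersive bound. So the evolution has size at least about 1/2 along times tending to 0, at every
point of an interval where the initial data vanish. -/

/-- The character `θ ↦ e^{iθ}` of the real line. -/
noncomputable def cis (θ : ℝ) : ℂ := Complex.exp (Complex.I * (θ : ℂ))

@[simp] lemma norm_cis (θ : ℝ) : ‖cis θ‖ = 1 := by
  rw [cis, mul_comm, Complex.norm_exp_ofReal_mul_I]

lemma cis_add (x y : ℝ) : cis (x + y) = cis x * cis y := by
  simp [cis, mul_add, Complex.exp_add]

@[simp] lemma cis_zero : cis 0 = 1 := by simp [cis]

lemma conj_cis (x : ℝ) : (starRingEnd ℂ) (cis x) = cis (-x) := by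
  simp [cis, ← Complex.exp_conj]

@[fun_prop] lemma continuous_cis : Continuous cis := by unfold cis; fun_prop

lemma hasDerivAt_cis_comp {F : ℝ → ℝ} {F' x : ℝ} (h : HasDerivAt F F' x) :
    HasDerivAt (fun y => cis (F y)) (cis (F x) * (Complex.I * F')) x := by
  have := ((h.ofReal_comp).const_mul Complex.I).cexp
  simpa [cis] using this

/-! ### Van der Corput estimates -/

/-- The first derivative van der Corput estimate with a decreasing amplitude. -/
lemma norm_integral_cis_le_of_le_abs_deriv {F F' F'' ψ ψ' : ℝ → ℝ} {a b l : ℝ} (hab : a ≤ b)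
    (hl : 0 < l) (hF : ∀ x, HasDerivAt F (F' x) x) (hF' : ∀ x, HasDerivAt F' (F'' x) x)
    (hm : Measurable ψ) (hψ : ∀ x ∈ Icc a b, HasDerivAt ψ (ψ' x) x)
    (hψ0 : ∀ x ∈ Icc a b, 0 ≤ ψ x) (hψ' : ∀ x ∈ Icc a b, ψ' x ≤ 0)
    (hF'' : ∀ x ∈ Icc a b, 0 ≤ F'' x) (hlF : ∀ x ∈ Ioo a b, l ≤ |F' x|) :
    ‖∫ x in a..b, cis (F x) * (ψ x : ℂ)‖ ≤ 5 * ψ a / l := by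
  have ha : a ∈ Icc a b := ⟨le_rfl, hab⟩
  have hψa := hψ0 a ha
  rcases hab.eq_or_lt with rfl | hlt
  · simp; positivity
  have hcF' : Continuous F' := continuous_iff_continuousAt.2 fun x => (hF' x).continuousAt
  have hcF : Continuous F := continuous_iff_continuousAt.2 fun x => (hF x).continuousAt
  -- The bound extends to the endpoints by continuity. Assuming it only inside lets pieces cut at a
  -- level set be used directly.
  have hlF : ∀ x ∈ Icc a b, l ≤ |F' x| := by
    intro x hx
    rw [← closure_Ioo hlt.ne] at hx
    exact closure_minimal hlF (isClosed_le continuous_const hcF'.abs) hx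
  have hne : ∀ x ∈ Icc a b, F' x ≠ 0 := fun x hx h => by
    have := hlF x hx; rw [h] at this; simp at this; linarith
  have hψc : ContinuousOn ψ (Icc a b) := fun x hx => (hψ x hx).continuousAt.continuousWithinAt
  have hψle : ∀ x ∈ Icc a b, ψ x ≤ ψ a := by
    intro x hx
    have : AntitoneOn ψ (Icc a b) := by
      apply antitoneOn_of_deriv_nonpos (convex_Icc a b) hψc
      · intro y hy
        exact (hψ y (interior_subset hy)).differentiableAt.differentiableWithinAt
      · intro y hy
        rw [(hψ y (interior_subset hy)).deriv]; exact hψ' y (interior_subset hy)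
    exact this ha hx hx.1
  set g : ℝ → ℂ := fun x => cis (F x) * (ψ x : ℂ) with hg
  have hgc : ContinuousOn g (Icc a b) :=
    (continuous_cis.comp hcF).continuousOn.mul (Complex.continuous_ofReal.comp_continuousOn hψc)
  have hgm : StronglyMeasurable g :=
    ((continuous_cis.comp hcF).measurable.mul
      (Complex.measurable_ofReal.comp hm)).stronglyMeasurable
  set h : ℝ → ℂ := fun x => cis (F x) * (((ψ x / F' x : ℝ) : ℂ) * (-Complex.I)) with hh
  set q : ℝ → ℝ := fun x => (ψ' x * F' x - ψ x * F'' x) / F' x ^ 2 with hq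
  have hderh : ∀ x ∈ Icc a b, HasDerivAt h (g x + cis (F x) * ((q x : ℂ) * (-Complex.I))) x := by
    intro x hx
    have h1 : HasDerivAt (fun y => ψ y / F' y) (q x) x := (hψ x hx).div (hF' x) (hne x hx)
    have h2 := (hasDerivAt_cis_comp (hF x)).mul (h1.ofReal_comp.mul_const (-Complex.I))
    refine HasDerivAt.congr_deriv h2 ?_
    simp only [hg, Complex.ofReal_div]
    have : (F' x : ℂ) ≠ 0 := by exact_mod_cast hne x hx
    field_simp
    linear_combination (-cis (F x) * ψ x) * Complex.I_sq
  have hderg : ∀ x ∈ Ico a b, HasDerivAt (fun u => ∫ y in a..u, g y) (g x) x := by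
    intro x hx
    apply intervalIntegral.integral_hasDerivAt_right
    · apply ContinuousOn.intervalIntegrable
      rw [uIcc_of_le hx.1]
      exact hgc.mono (Icc_subset_Icc_right hx.2.le)
    · exact hgm.stronglyMeasurableAtFilter
    · exact (continuous_cis.comp hcF).continuousAt.mul
        (Complex.continuous_ofReal.continuousAt.comp (hψ x ⟨hx.1, hx.2.le⟩).continuousAt)
  have hcg : ContinuousOn (fun u => ∫ y in a..u, g y) (Icc a b) := by
    rw [← uIcc_of_le hab]
    apply intervalIntegral.continuousOn_primitive_interval
    rw [uIcc_of_le hab]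
    exact hgc.integrableOn_Icc
  -- Integration by parts leaves the error `q`, the derivative of ψ/F'. `M` is an explicit primitive
  -- of a majorant of |q|, of total growth at most 3ψ(a)/l; the two boundary terms of `h` bring the
  -- constant to 5. Comparing derivatives instead of integrating `q` requires no integrability of ψ'
  -- or F''.
  set M : ℝ → ℝ := fun x => - (ψ x / l) - ψ a / F' x with hM
  have hderM : ∀ x ∈ Icc a b, HasDerivAt M (-(ψ' x / l) + ψ a * F'' x / F' x ^ 2) x := by
    intro x hx
    have h1 := ((hψ x hx).div_const l).neg.sub ((hasDerivAt_const x (ψ a)).div (hF' x) (hne x hx))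
    refine HasDerivAt.congr_deriv h1 ?_
    ring
  have hhc : ContinuousOn h (Icc a b) := fun x hx => (hderh x hx).continuousAt.continuousWithinAt
  have hMc : ContinuousOn M (Icc a b) := fun x hx => (hderM x hx).continuousAt.continuousWithinAt
  have key := image_norm_le_of_norm_deriv_right_le_deriv_boundary'
    (f := fun x => (∫ y in a..x, g y) - (h x - h a)) (a := a) (b := b)
    (f' := fun x => g x - (g x + cis (F x) * ((q x : ℂ) * (-Complex.I))))
    (hcg.sub (hhc.sub continuousOn_const))
    (fun x hx => ((hderg x hx).sub
      ((hderh x ⟨hx.1, hx.2.le⟩).sub_const (h a))).hasDerivWithinAt)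
    (B := fun x => M x - M a) (B' := fun x => -(ψ' x / l) + ψ a * F'' x / F' x ^ 2)
    (by simp) (hMc.sub continuousOn_const)
    (fun x hx => ((hderM x ⟨hx.1, hx.2.le⟩).sub_const (M a)).hasDerivWithinAt)
    (by
      intro x hx
      have hx' : x ∈ Icc a b := ⟨hx.1, hx.2.le⟩
      have e1 : ‖g x - (g x + cis (F x) * ((q x : ℂ) * (-Complex.I)))‖ = |q x| := by
        rw [sub_add_cancel_left, norm_neg]; simp
      rw [e1]
      have e2 : q x = ψ' x / F' x - ψ x * F'' x / F' x ^ 2 := by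
        have := hne x hx'
        simp only [hq]; field_simp
      rw [e2]
      refine (abs_sub _ _).trans (add_le_add ?_ ?_)
      · rw [abs_div, abs_of_nonpos (hψ' x hx'), ← neg_div]
        exact div_le_div_of_nonneg_left (by linarith [hψ' x hx']) hl (hlF x hx')
      · rw [abs_of_nonneg (div_nonneg (mul_nonneg (hψ0 x hx') (hF'' x hx')) (sq_nonneg _))]
        exact div_le_div_of_nonneg_right
          (mul_le_mul_of_nonneg_right (hψle x hx') (hF'' x hx')) (sq_nonneg _))
    (x := b) ⟨hab, le_rfl⟩
  have hhb : ∀ x ∈ Icc a b, ‖h x‖ ≤ ψ a / l := by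
    intro x hx
    simp only [hh, norm_mul, norm_cis, one_mul, Complex.norm_real, norm_neg, Complex.norm_I, mul_one,
      Real.norm_eq_abs, abs_div, abs_of_nonneg (hψ0 x hx)]
    exact div_le_div₀ hψa (hψle x hx) hl (hlF x hx)
  have hMb : M b - M a ≤ 3 * (ψ a / l) := by
    have hb : b ∈ Icc a b := ⟨hab, le_rfl⟩
    have h1 : ∀ x ∈ Icc a b, |ψ a / F' x| ≤ ψ a / l := by
      intro x hx
      rw [abs_div, abs_of_nonneg hψa]
      exact div_le_div_of_nonneg_left hψa hl (hlF x hx)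
    have h2 := neg_abs_le (ψ a / F' b)
    have h3 := le_abs_self (ψ a / F' a)
    have h4 := h1 a ha
    have h5 := h1 b hb
    have h6 : 0 ≤ ψ b / l := div_nonneg (hψ0 b hb) hl.le
    simp only [hM]
    linarith
  have h1 := hhb a ha
  have h2 := hhb b ⟨hab, le_rfl⟩
  calc ‖∫ y in a..b, g y‖ = ‖((∫ y in a..b, g y) - (h b - h a)) + h b - h a‖ := by congr 1; ring
    _ ≤ ‖(∫ y in a..b, g y) - (h b - h a)‖ + ‖h b‖ + ‖h a‖ :=
      (norm_sub_le _ _).trans (add_le_add_left (norm_add_le _ _) _)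
    _ ≤ 5 * ψ a / l := by
      have : 5 * ψ a / l = 5 * (ψ a / l) := by ring
      rw [this]; linarith

/-- The cut is the supremum of `{a} ∪ {G ≤ l}`. Both conclusions concern open intervals, so no
continuity is needed and either side may be empty. It serves to separate nearly stationary
frequencies from the others. -/
lemma exists_cut {G : ℝ → ℝ} {a b : ℝ} (hab : a ≤ b) (hG : MonotoneOn G (Icc a b)) (l : ℝ) :
    ∃ c ∈ Icc a b, (∀ x ∈ Ioo a c, G x ≤ l) ∧ ∀ x ∈ Ioo c b, l ≤ G x := by
  set S : Set ℝ := insert a {x ∈ Icc a b | G x ≤ l} with hS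
  have hne : S.Nonempty := ⟨a, by simp [hS]⟩
  have hSb : ∀ x ∈ S, x ∈ Icc a b := by
    rintro x (rfl | hx)
    · exact ⟨le_rfl, hab⟩
    · exact hx.1
  have hbdd : BddAbove S := ⟨b, fun x hx => (hSb x hx).2⟩
  have haS : a ≤ sSup S := le_csSup hbdd (by simp [hS])
  have hSb' : sSup S ≤ b := csSup_le hne fun x hx => (hSb x hx).2
  refine ⟨sSup S, ⟨haS, hSb'⟩, ?_, ?_⟩
  · intro x hx
    obtain ⟨y, hy, hxy⟩ := exists_lt_of_lt_csSup hne hx.2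
    rcases hy with rfl | hy
    · exact absurd hx.1 (not_lt.2 hxy.le)
    · exact (hG ⟨hx.1.le, hx.2.le.trans hSb'⟩ hy.1 hxy.le).trans hy.2
  · intro x hx
    by_contra! h
    have : x ∈ S := Or.inr ⟨⟨haS.trans hx.1.le, hx.2.le⟩, h.le⟩
    exact absurd (le_csSup hbdd this) (not_le.2 hx.1)

/-- The second derivative van der Corput estimate with a decreasing amplitude. -/
lemma norm_integral_cis_le_of_le_deriv2 {F F' F'' ψ ψ' : ℝ → ℝ} {a b m : ℝ} (hab : a ≤ b)
    (hm0 : 0 < m) (hF : ∀ x, HasDerivAt F (F' x) x) (hF' : ∀ x, HasDerivAt F' (F'' x) x)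
    (hm : Measurable ψ) (hψ : ∀ x ∈ Icc a b, HasDerivAt ψ (ψ' x) x)
    (hψ0 : ∀ x ∈ Icc a b, 0 ≤ ψ x) (hψ' : ∀ x ∈ Icc a b, ψ' x ≤ 0)
    (hF'' : ∀ x ∈ Icc a b, m ≤ F'' x) :
    ‖∫ x in a..b, cis (F x) * (ψ x : ℂ)‖ ≤ 12 * ψ a / √m := by
  have ha : a ∈ Icc a b := ⟨le_rfl, hab⟩
  have hψa := hψ0 a ha
  have hcF' : Continuous F' := continuous_iff_continuousAt.2 fun x => (hF' x).continuousAt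
  have hcF : Continuous F := continuous_iff_continuousAt.2 fun x => (hF x).continuousAt
  have hψc : ContinuousOn ψ (Icc a b) := fun x hx => (hψ x hx).continuousAt.continuousWithinAt
  have hψanti : AntitoneOn ψ (Icc a b) := by
    apply antitoneOn_of_deriv_nonpos (convex_Icc a b) hψc
    · intro y hy
      exact (hψ y (interior_subset hy)).differentiableAt.differentiableWithinAt
    · intro y hy
      rw [(hψ y (interior_subset hy)).deriv]; exact hψ' y (interior_subset hy)
  have hgrow : ∀ x ∈ Icc a b, ∀ y ∈ Icc a b, x ≤ y → m * (y - x) ≤ F' y - F' x := by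
    apply Convex.mul_sub_le_image_sub_of_le_deriv (convex_Icc a b) hcF'.continuousOn
    · intro y hy
      exact (hF' y).differentiableAt.differentiableWithinAt
    · intro y hy
      rw [(hF' y).deriv]; exact hF'' y (interior_subset hy)
  have hmono : MonotoneOn F' (Icc a b) := by
    intro x hx y hy hxy
    have := hgrow x hx y hy hxy
    have : 0 ≤ m * (y - x) := mul_nonneg hm0.le (by linarith)
    linarith
  have hs : 0 < √m := Real.sqrt_pos.2 hm0
  obtain ⟨c, hc, hc1, hc2⟩ := exists_cut hab hmono (-√m)
  obtain ⟨d, hd, hd1, hd2⟩ := exists_cut hc.2 (hmono.mono (Icc_subset_Icc_left hc.1)) (√m)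
  have sub1 : Icc a c ⊆ Icc a b := Icc_subset_Icc_right hc.2
  have sub2 : Icc c d ⊆ Icc a b := Icc_subset_Icc hc.1 hd.2
  have sub3 : Icc d b ⊆ Icc a b := Icc_subset_Icc_left (hc.1.trans hd.1)
  have b1 := norm_integral_cis_le_of_le_abs_deriv hc.1 hs hF hF' hm
    (fun x hx => hψ x (sub1 hx)) (fun x hx => hψ0 x (sub1 hx)) (fun x hx => hψ' x (sub1 hx))
    (fun x hx => hm0.le.trans (hF'' x (sub1 hx)))
    (fun x hx => by have := hc1 x hx; rw [le_abs]; right; linarith)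
  have b3 := norm_integral_cis_le_of_le_abs_deriv hd.2 hs hF hF' hm
    (fun x hx => hψ x (sub3 hx)) (fun x hx => hψ0 x (sub3 hx)) (fun x hx => hψ' x (sub3 hx))
    (fun x hx => hm0.le.trans (hF'' x (sub3 hx)))
    (fun x hx => by have := hd2 x hx; rw [le_abs]; left; linarith)
  have hdm : d ∈ Icc a b := ⟨hc.1.trans hd.1, hd.2⟩
  have b3' : 5 * ψ d / √m ≤ 5 * ψ a / √m := by
    have := hψanti ha hdm hdm.1
    gcongr
  -- Between the cuts F' rises by at most 2√m, but at rate at least m. The three pieces contribute 5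
  -- + 2 + 5 = 12.
  have hlen : d - c ≤ 2 / √m := by
    rcases hd.1.eq_or_lt with h | h
    · rw [h, sub_self]; positivity
    have key : F' d - F' c ≤ 2 * √m := by
      have u1 : ∀ x ∈ Icc c d, F' x ≤ √m := by
        intro x hx
        rw [← closure_Ioo h.ne] at hx
        exact closure_minimal hd1 (isClosed_le hcF' continuous_const) hx
      have u2 : ∀ x ∈ Icc c d, -√m ≤ F' x := by
        intro x hx
        rw [← closure_Ioo h.ne] at hx
        exact closure_minimal (fun y hy => hc2 y ⟨hy.1, hy.2.trans_le hd.2⟩)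
          (isClosed_le continuous_const hcF') hx
      linarith [u1 d ⟨hd.1, le_rfl⟩, u2 c ⟨le_rfl, hd.1⟩]
    have := hgrow c hc d hdm hd.1
    rw [le_div_iff₀ hs]
    have h3 : √m * √m = m := Real.mul_self_sqrt hm0.le
    by_contra! hcon
    have : √m * ((d - c) * √m) ≤ 2 * √m := by
      calc √m * ((d - c) * √m) = (√m * √m) * (d - c) := by ring
        _ = m * (d - c) := by rw [h3]
        _ ≤ _ := by linarith
    nlinarith
  have b2 : ‖∫ x in c..d, cis (F x) * (ψ x : ℂ)‖ ≤ ψ a * |d - c| := by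
    apply intervalIntegral.norm_integral_le_of_norm_le_const
    intro x hx
    rw [uIoc_of_le hd.1] at hx
    have hx' : x ∈ Icc a b := sub2 ⟨hx.1.le, hx.2⟩
    rw [norm_mul, norm_cis, one_mul, Complex.norm_real, Real.norm_eq_abs,
      abs_of_nonneg (hψ0 x hx')]
    exact hψanti ha hx' hx'.1
  rw [abs_of_nonneg (by linarith [hd.1])] at b2
  have b2' : ψ a * (d - c) ≤ 2 * ψ a / √m := by
    calc ψ a * (d - c) ≤ ψ a * (2 / √m) := by gcongr
      _ = _ := by ring
  have hint : ∀ u v, u ∈ Icc a b → v ∈ Icc a b →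
      IntervalIntegrable (fun x => cis (F x) * (ψ x : ℂ)) volume u v := by
    intro u v hu hv
    apply ContinuousOn.intervalIntegrable
    apply ((continuous_cis.comp hcF).continuousOn.mul
      (Complex.continuous_ofReal.comp_continuousOn hψc)).mono
    exact uIcc_subset_Icc hu hv
  rw [← intervalIntegral.integral_add_adjacent_intervals (hint a c ha hc)
      (hint c b hc ⟨hab, le_rfl⟩),
    ← intervalIntegral.integral_add_adjacent_intervals (hint c d hc hdm)
      (hint d b hdm ⟨hab, le_rfl⟩)]
  have e : 12 * ψ a / √m = 5 * ψ a / √m + (2 * ψ a / √m + 5 * ψ a / √m) := by ring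
  rw [e]
  refine (norm_add_le _ _).trans (add_le_add b1 ((norm_add_le _ _).trans (add_le_add ?_ ?_)))
  · exact b2.trans b2'
  · exact b3.trans b3'

/-! ### The dispersion relation and its derivatives -/

/-- The dispersion relation `|ξ| √(1 + |ξ|²)` of the Boussinesq operator. -/
noncomputable def disp (ξ : ℝ) : ℝ := |ξ| * √(1 + |ξ| ^ 2)

/-- The smooth odd function that agrees with `disp` on the positive half line. -/
noncomputable def dispOdd (ξ : ℝ) : ℝ := ξ * √(1 + ξ ^ 2)

/-- The derivative of `dispOdd`. -/
noncomputable def dispOdd' (ξ : ℝ) : ℝ := (1 + 2 * ξ ^ 2) / √(1 + ξ ^ 2)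

/-- The second derivative of `dispOdd`. -/
noncomputable def dispOdd'' (ξ : ℝ) : ℝ := ξ * (3 + 2 * ξ ^ 2) / ((1 + ξ ^ 2) * √(1 + ξ ^ 2))

lemma disp_of_nonneg {ξ : ℝ} (h : 0 ≤ ξ) : disp ξ = dispOdd ξ := by
  simp [disp, dispOdd, abs_of_nonneg h]

@[simp] lemma disp_neg (ξ : ℝ) : disp (-ξ) = disp ξ := by simp [disp]

@[fun_prop] lemma continuous_disp : Continuous disp := by unfold disp; fun_prop

lemma disp_nonneg (ξ : ℝ) : 0 ≤ disp ξ := by unfold disp; positivity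

lemma disp_le (ξ : ℝ) : disp ξ ≤ |ξ| + ξ ^ 2 := by
  have h1 : √(1 + |ξ| ^ 2) ≤ 1 + |ξ| := by
    rw [Real.sqrt_le_left (by positivity)]; nlinarith [abs_nonneg ξ]
  have := mul_le_mul_of_nonneg_left h1 (abs_nonneg ξ)
  rw [← sq_abs ξ]; unfold disp; linarith

lemma sqrt_one_add_sq_mul_self (ξ : ℝ) : √(1 + ξ ^ 2) * √(1 + ξ ^ 2) = 1 + ξ ^ 2 :=
  Real.mul_self_sqrt (by positivity)

lemma hasDerivAt_sqrt_one_add_sq (ξ : ℝ) :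
    HasDerivAt (fun x : ℝ => √(1 + x ^ 2)) (ξ / √(1 + ξ ^ 2)) ξ := by
  have h := (((hasDerivAt_id ξ).pow 2).const_add 1).sqrt (by simp; positivity)
  refine HasDerivAt.congr_deriv h ?_
  simp
  field_simp

lemma hasDerivAt_dispOdd (ξ : ℝ) : HasDerivAt dispOdd (dispOdd' ξ) ξ := by
  refine HasDerivAt.congr_deriv ((hasDerivAt_id ξ).mul (hasDerivAt_sqrt_one_add_sq ξ)) ?_
  have h := sqrt_one_add_sq_mul_self ξ
  have h0 : 0 < √(1 + ξ ^ 2) := Real.sqrt_pos.2 (by positivity)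
  simp only [dispOdd', id]
  field_simp
  linear_combination h

lemma hasDerivAt_dispOdd' (ξ : ℝ) : HasDerivAt dispOdd' (dispOdd'' ξ) ξ := by
  have h0 : 0 < √(1 + ξ ^ 2) := Real.sqrt_pos.2 (by positivity)
  have h1 : HasDerivAt (fun x : ℝ => 1 + 2 * x ^ 2) (4 * ξ) ξ := by
    refine HasDerivAt.congr_deriv ((((hasDerivAt_id ξ).pow 2).const_mul 2).const_add 1) ?_
    simp; ring
  refine HasDerivAt.congr_deriv (h1.div (hasDerivAt_sqrt_one_add_sq ξ) h0.ne') ?_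
  have h := sqrt_one_add_sq_mul_self ξ
  simp only [dispOdd'']
  rw [← h]
  field_simp
  have h2 : √(1 + ξ ^ 2) ^ 2 = 1 + ξ ^ 2 := by rw [sq, h]
  simp only [h2]
  ring

lemma sqrt_one_add_sq_le {ξ : ℝ} (h : 0 ≤ ξ) : √(1 + ξ ^ 2) ≤ 1 + ξ := by
  rw [Real.sqrt_le_left (by positivity)]; nlinarith

lemma le_sqrt_one_add_sq (ξ : ℝ) : ξ ≤ √(1 + ξ ^ 2) := Real.le_sqrt_of_sq_le (by linarith)

lemma le_dispOdd' {ξ : ℝ} (h : 0 ≤ ξ) : ξ ≤ dispOdd' ξ := by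
  have h0 : 0 < √(1 + ξ ^ 2) := Real.sqrt_pos.2 (by positivity)
  rw [dispOdd', le_div_iff₀ h0]
  have := mul_le_mul_of_nonneg_left (sqrt_one_add_sq_le h) h
  nlinarith [sq_nonneg (ξ - 1)]

lemma dispOdd'_le {ξ : ℝ} (h : 1 ≤ ξ) : dispOdd' ξ ≤ 3 * ξ := by
  have h0 : 0 < √(1 + ξ ^ 2) := Real.sqrt_pos.2 (by positivity)
  rw [dispOdd', div_le_iff₀ h0]
  have := mul_le_mul_of_nonneg_left (le_sqrt_one_add_sq ξ) (by linarith : 0 ≤ ξ)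
  nlinarith

lemma one_le_dispOdd'' {ξ : ℝ} (h : 1 ≤ ξ) : 1 ≤ dispOdd'' ξ := by
  have h0 : 0 < √(1 + ξ ^ 2) := Real.sqrt_pos.2 (by positivity)
  rw [dispOdd'', le_div_iff₀ (by positivity), one_mul]
  have := mul_le_mul_of_nonneg_left (sqrt_one_add_sq_le (by linarith : 0 ≤ ξ))
    (by positivity : 0 ≤ 1 + ξ ^ 2)
  nlinarith [mul_nonneg (by positivity : 0 ≤ 1 + ξ ^ 2) (by linarith : 0 ≤ ξ - 1)]

lemma dispOdd''_le {ξ : ℝ} (h : 0 ≤ ξ) : dispOdd'' ξ ≤ 3 := by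
  have h0 : 0 < √(1 + ξ ^ 2) := Real.sqrt_pos.2 (by positivity)
  rw [dispOdd'', div_le_iff₀ (by positivity)]
  have := mul_le_mul_of_nonneg_left (le_sqrt_one_add_sq ξ) (by positivity : 0 ≤ 3 * (1 + ξ ^ 2))
  nlinarith [pow_nonneg h 3]

/-- The amplitude is real, so conjugation only flips the sign of the phase. This reduces t < 0 to t
> 0, where the phase is convex on positive frequencies. -/
lemma norm_integral_cis_neg (F ψ : ℝ → ℝ) (a b : ℝ) :
    ‖∫ x in a..b, cis (-F x) * (ψ x : ℂ)‖ = ‖∫ x in a..b, cis (F x) * (ψ x : ℂ)‖ := by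
  rw [← Complex.norm_conj (∫ x in a..b, cis (F x) * (ψ x : ℂ))]
  congr 1
  simp only [intervalIntegral, map_sub, ← integral_conj, map_mul, conj_cis, Complex.conj_ofReal]

lemma hasDerivAt_phase (x t ξ : ℝ) :
    HasDerivAt (fun ξ => x * ξ + t * dispOdd ξ) (x + t * dispOdd' ξ) ξ :=
  HasDerivAt.congr_deriv (((hasDerivAt_id ξ).const_mul x).add ((hasDerivAt_dispOdd ξ).const_mul t))
    (by simp)

lemma hasDerivAt_phase' (x t ξ : ℝ) :
    HasDerivAt (fun ξ => x + t * dispOdd' ξ) (t * dispOdd'' ξ) ξ := by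
  simpa using ((hasDerivAt_dispOdd' ξ).const_mul t).const_add x

/-- The van der Corput lemmas ask for a phase differentiable on the whole line, which `disp` is not
because of its corner at 0. -/
lemma integral_disp_congr {x t a b : ℝ} (ψ : ℝ → ℂ) (ha : 0 ≤ a) (hab : a ≤ b) :
    ∫ ξ in a..b, cis (x * ξ + t * disp ξ) * ψ ξ =
      ∫ ξ in a..b, cis (x * ξ + t * dispOdd ξ) * ψ ξ := by
  apply intervalIntegral.integral_congr
  intro ξ hξ
  rw [uIcc_of_le hab] at hξ
  simp only [disp_of_nonneg (ha.trans hξ.1)]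

lemma hasDerivAt_rpow_neg_half {ξ : ℝ} (h : 1 ≤ ξ) :
    HasDerivAt (fun ξ : ℝ => ξ ^ (-(1 / 2) : ℝ)) (-(1 / 2) * ξ ^ (-(1 / 2) - 1 : ℝ)) ξ :=
  Real.hasDerivAt_rpow_const (Or.inl (by linarith))

/-! ### Kernel bounds -/

/-- The dispersive kernel, truncated to frequencies in `[a, b]`, is bounded by `|t|^{-1/2}`. -/
lemma norm_integral_dispersive_le {x t a b : ℝ} (ht : t ≠ 0) (ha : 1 ≤ a) (hab : a ≤ b) :
    ‖∫ ξ in a..b, cis (x * ξ + t * disp ξ)‖ ≤ 12 / √|t| := by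
  have h1 : ∀ x' t' : ℝ, 0 < t' → ‖∫ ξ in a..b, cis (x' * ξ + t' * disp ξ) * ((1 : ℝ) : ℂ)‖
      ≤ 12 / √t' := by
    intro x' t' ht'
    rw [integral_disp_congr _ (by linarith) hab]
    have := norm_integral_cis_le_of_le_deriv2 (ψ := fun _ => 1) (ψ' := fun _ => 0) hab ht'
      (hasDerivAt_phase x' t') (hasDerivAt_phase' x' t') measurable_const
      (fun y _ => hasDerivAt_const y 1) (fun _ _ => zero_le_one) (fun _ _ => le_rfl)
      (fun y hy => by nlinarith [one_le_dispOdd'' (ha.trans hy.1)])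
    simpa using this
  rcases lt_or_gt_of_ne ht with h | h
  · rw [abs_of_neg h]
    have h2 := h1 (-x) (-t) (by linarith)
    have h3 := norm_integral_cis_neg (fun ξ => x * ξ + t * disp ξ) (fun _ => 1) a b
    have e : ∀ ξ, -(x * ξ + t * disp ξ) = -x * ξ + -t * disp ξ := fun ξ => by ring
    simp only [e] at h3
    rw [h3] at h2
    simpa using h2
  · rw [abs_of_pos h]
    simpa using h1 x t h

/-- The kernel with the amplitude `|ξ|^{-1/2}` is bounded by a multiple of `|x|^{-1/2}`, uniformly
in time and in the frequency window. -/
lemma norm_integral_maximal_kernel_le {x t a b : ℝ} (hx : x ≠ 0) (ha : 1 ≤ a) (hab : a ≤ b) :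
    ‖∫ ξ in a..b, cis (x * ξ + t * disp ξ) * ((ξ ^ (-(1 / 2) : ℝ) : ℝ) : ℂ)‖
      ≤ 60 / √|x| := by
  set ψ : ℝ → ℝ := fun ξ => ξ ^ (-(1 / 2) : ℝ) with hψdef
  have hψsqrt : ∀ ξ : ℝ, 0 ≤ ξ → ψ ξ = 1 / √ξ := by
    intro ξ hξ
    simp only [hψdef]
    rw [Real.rpow_neg hξ, Real.sqrt_eq_rpow]
    exact (one_div _).symm
  have hψm : Measurable ψ := by simp only [hψdef]; fun_prop
  have hax : 0 < |x| := abs_pos.2 hx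
  have hsx : 0 < √|x| := Real.sqrt_pos.2 hax
  have hψ0 : ∀ ξ : ℝ, 1 ≤ ξ → 0 ≤ ψ ξ := fun ξ hξ => Real.rpow_nonneg (by linarith) _
  have hψ' : ∀ ξ : ℝ, 1 ≤ ξ → -(1 / 2) * ξ ^ (-(1 / 2) - 1 : ℝ) ≤ 0 := fun ξ hξ => by
    have := Real.rpow_nonneg (by linarith : 0 ≤ ξ) (-(1 / 2) - 1)
    linarith
  have hint : ∀ t u v, 1 ≤ u → u ≤ v →
      IntervalIntegrable (fun ξ => cis (x * ξ + t * disp ξ) * (ψ ξ : ℂ)) volume u v := by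
    intro t u v hu huv
    apply ContinuousOn.intervalIntegrable
    rw [uIcc_of_le huv]
    apply ContinuousOn.mul (Continuous.continuousOn (by fun_prop))
    apply Complex.continuous_ofReal.comp_continuousOn
    intro y hy
    exact (hasDerivAt_rpow_neg_half (hu.trans hy.1)).continuousAt.continuousWithinAt
  -- frequencies above `1 / |x|`
  have hhigh : ∀ (x t a b : ℝ), x ≠ 0 → 0 ≤ t → 1 ≤ a → 1 / |x| ≤ a → a ≤ b →
      ‖∫ ξ in a..b, cis (x * ξ + t * disp ξ) * (ψ ξ : ℂ)‖ ≤ 56 / √|x| := by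
    intro x t a b hx ht ha hax' hab
    have hax : 0 < |x| := abs_pos.2 hx
    have hsx : 0 < √|x| := Real.sqrt_pos.2 hax
    have hψa : ∀ ξ, a ≤ ξ → ψ ξ ≤ √|x| := by
      intro ξ hξ
      have hξ0 : 0 < ξ := by linarith
      rw [hψsqrt ξ hξ0.le, div_le_iff₀ (Real.sqrt_pos.2 hξ0), ← Real.sqrt_mul hax.le]
      rw [Real.le_sqrt zero_le_one (by positivity)]
      have := (div_le_iff₀ hax).1 (hax'.trans hξ)
      linarith
    rw [integral_disp_congr _ (by linarith) hab]
    -- Above 1/|x| the amplitude is at most √|x|, so away from stationary points the bound is 5√|x|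
    -- / (|x|/2) = 10/√|x|.
    have hfirst : ∀ u v, a ≤ u → u ≤ v → (∀ ξ ∈ Ioo u v, |x| / 2 ≤ |x + t * dispOdd' ξ|) →
        ‖∫ ξ in u..v, cis (x * ξ + t * dispOdd ξ) * (ψ ξ : ℂ)‖ ≤ 10 / √|x| := by
      intro u v hu huv hlow
      have h1 := norm_integral_cis_le_of_le_abs_deriv huv (by positivity : 0 < |x| / 2)
        (hasDerivAt_phase x t) (hasDerivAt_phase' x t) hψm
        (fun y hy => hasDerivAt_rpow_neg_half (ha.trans (hu.trans hy.1)))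
        (fun y hy => hψ0 y (ha.trans (hu.trans hy.1)))
        (fun y hy => hψ' y (ha.trans (hu.trans hy.1)))
        (fun y hy => mul_nonneg ht
          (zero_le_one.trans (one_le_dispOdd'' (ha.trans (hu.trans hy.1))))) hlow
      refine h1.trans ?_
      rw [div_le_div_iff₀ (by positivity) hsx]
      have h2 := mul_le_mul_of_nonneg_right (hψa u hu) hsx.le
      rw [Real.mul_self_sqrt hax.le] at h2
      linarith
    rcases ht.eq_or_lt with rfl | ht
    · refine (hfirst a b le_rfl hab fun ξ _ => ?_).trans ?_
      · simp
      · gcongr; norm_num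
    have hmono : ∀ u v, 1 ≤ u → MonotoneOn (fun ξ => x + t * dispOdd' ξ) (Icc u v) := by
      intro u v hu
      apply monotoneOn_of_deriv_nonneg (convex_Icc u v)
      · exact fun y _ => (hasDerivAt_phase' x t y).continuousAt.continuousWithinAt
      · exact fun y _ => (hasDerivAt_phase' x t y).differentiableAt.differentiableWithinAt
      · intro y hy
        rw [(hasDerivAt_phase' x t y).deriv]
        exact mul_nonneg ht.le
          (zero_le_one.trans (one_le_dispOdd'' (hu.trans (interior_subset hy).1)))
    obtain ⟨c, hc, hc1, hc2⟩ := exists_cut hab (hmono a b ha) (-(|x| / 2))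
    obtain ⟨d, hd, hd1, hd2⟩ := exists_cut hc.2 (hmono c b (ha.trans hc.1)) (|x| / 2)
    have b1 := hfirst a c le_rfl hc.1 fun ξ hξ => by
      have := hc1 ξ hξ; rw [le_abs]; right; linarith
    have b3 := hfirst d b (hc.1.trans hd.1) hd.2 fun ξ hξ => by
      have := hd2 ξ hξ; rw [le_abs]; left; linarith
    have b2 : ‖∫ ξ in c..d, cis (x * ξ + t * dispOdd ξ) * (ψ ξ : ℂ)‖ ≤ 36 / √|x| := by
      rcases hd.1.eq_or_lt with hcd | hcd
      · rw [← hcd, intervalIntegral.integral_same, norm_zero]; positivity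
      have hca : 1 ≤ c := ha.trans hc.1
      have h1 := norm_integral_cis_le_of_le_deriv2 hd.1 ht
        (hasDerivAt_phase x t) (hasDerivAt_phase' x t) hψm
        (fun y hy => hasDerivAt_rpow_neg_half (hca.trans hy.1))
        (fun y hy => hψ0 y (hca.trans hy.1))
        (fun y hy => hψ' y (hca.trans hy.1))
        (fun y hy => by nlinarith [one_le_dispOdd'' (hca.trans hy.1)])
      refine h1.trans ?_
      have hc3 : -(|x| / 2) ≤ x + t * dispOdd' c ∧ x + t * dispOdd' c ≤ |x| / 2 := by
        have hcont : Continuous fun ξ => x + t * dispOdd' ξ :=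
          continuous_iff_continuousAt.2 fun y => (hasDerivAt_phase' x t y).continuousAt
        have hsub : Icc c d ⊆ {ξ | -(|x| / 2) ≤ x + t * dispOdd' ξ ∧ x + t * dispOdd' ξ ≤ |x| / 2}
            := by
          rw [← closure_Ioo hcd.ne]
          apply closure_minimal
          · exact fun ξ hξ => ⟨hc2 ξ ⟨hξ.1, hξ.2.trans_le hd.2⟩, hd1 ξ hξ⟩
          · exact (isClosed_le continuous_const hcont).inter (isClosed_le hcont continuous_const)
        exact hsub ⟨le_rfl, hcd.le⟩
      -- Near stationarity tω'(c) ≥ |x|/2 while ω'(c) ≤ 3c, so ct ≥ |x|/6. The second derivative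
      -- bound 12(ct)^{-1/2} is then at most 12√6/√|x|, and √6 ≤ 3 gives 36.
      have h4 : |x| / 2 ≤ t * (3 * c) := by
        have h5 := mul_le_mul_of_nonneg_left (dispOdd'_le hca) ht.le
        have h6 : 0 ≤ t * dispOdd' c :=
          mul_nonneg ht.le ((by linarith : 0 ≤ c).trans (le_dispOdd' (by linarith)))
        rcases abs_cases x with ⟨h, _⟩ | ⟨h, _⟩ <;> rw [h] at hc3 ⊢ <;> linarith
      have hc0 : 0 < c := by linarith
      have hst : 0 < √t := Real.sqrt_pos.2 ht
      have hsc : 0 < √c := Real.sqrt_pos.2 hc0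
      rw [hψsqrt c hc0.le]
      rw [div_le_div_iff₀ hst hsx]
      have h7 : √|x| ≤ 3 * (√t * √c) := by
        rw [Real.sqrt_le_left (by positivity), mul_pow, mul_pow, Real.sq_sqrt ht.le,
          Real.sq_sqrt hc0.le]
        nlinarith
      have h8 : 12 * (1 / √c) * √|x| ≤ 12 * (1 / √c) * (3 * (√t * √c)) := by gcongr
      refine h8.trans (le_of_eq ?_)
      field_simp
      norm_num
    have hint' : ∀ u v, 1 ≤ u → u ≤ v →
        IntervalIntegrable (fun ξ => cis (x * ξ + t * dispOdd ξ) * (ψ ξ : ℂ)) volume u v := by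
      intro u v hu huv
      apply ContinuousOn.intervalIntegrable
      rw [uIcc_of_le huv]
      apply ContinuousOn.mul
      · exact (continuous_cis.comp (continuous_iff_continuousAt.2 fun y =>
          (hasDerivAt_phase x t y).continuousAt)).continuousOn
      apply Complex.continuous_ofReal.comp_continuousOn
      intro y hy
      exact (hasDerivAt_rpow_neg_half (hu.trans hy.1)).continuousAt.continuousWithinAt
    have ha1 := hc.1
    have ha2 := hd.1
    rw [← intervalIntegral.integral_add_adjacent_intervals (hint' a c ha hc.1)
        (hint' c b (by linarith) hc.2),
      ← intervalIntegral.integral_add_adjacent_intervals (hint' c d (by linarith) hd.1)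
        (hint' d b (by linarith) hd.2)]
    have e : 56 / √|x| = 10 / √|x| + (36 / √|x| + 10 / √|x|) := by ring
    rw [e]
    exact (norm_add_le _ _).trans (add_le_add b1 ((norm_add_le _ _).trans (add_le_add b2 b3)))
  have hhigh' : ∀ a b, 1 ≤ a → 1 / |x| ≤ a → a ≤ b →
      ‖∫ ξ in a..b, cis (x * ξ + t * disp ξ) * (ψ ξ : ℂ)‖ ≤ 56 / √|x| := by
    intro a b ha hax' hab
    rcases le_total 0 t with ht | ht
    · exact hhigh x t a b hx ht ha hax' hab
    · have h2 := hhigh (-x) (-t) a b (neg_ne_zero.2 hx) (by linarith) ha (by rwa [abs_neg]) hab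
      have h3 := norm_integral_cis_neg (fun ξ => x * ξ + t * disp ξ) ψ a b
      have e : ∀ ξ, -(x * ξ + t * disp ξ) = -x * ξ + -t * disp ξ := fun ξ => by ring
      simp only [e] at h3
      rwa [h3, abs_neg] at h2
  -- frequencies below `1 / |x|`
  have hlow : ∀ a b, 1 ≤ a → a ≤ b → b ≤ 1 / |x| →
      ‖∫ ξ in a..b, cis (x * ξ + t * disp ξ) * (ψ ξ : ℂ)‖ ≤ 2 / √|x| := by
    intro a b ha hab hb
    have h1 : ‖∫ ξ in a..b, cis (x * ξ + t * disp ξ) * (ψ ξ : ℂ)‖ ≤ ∫ ξ in a..b, ψ ξ := by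
      refine intervalIntegral.norm_integral_le_of_norm_le hab ?_ ?_
      · refine Eventually.of_forall fun ξ hξ => ?_
        rw [norm_mul, norm_cis, one_mul, Complex.norm_real, Real.norm_eq_abs,
          abs_of_nonneg (hψ0 ξ (ha.trans hξ.1.le))]
      · exact intervalIntegral.intervalIntegrable_rpow' (by norm_num)
    refine h1.trans ?_
    simp only [hψdef]
    rw [integral_rpow (Or.inl (by norm_num))]
    have e1 : (-(1 / 2) + 1 : ℝ) = 1 / 2 := by norm_num
    rw [e1, ← Real.sqrt_eq_rpow, ← Real.sqrt_eq_rpow]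
    have h2 : √b ≤ 1 / √|x| := by
      rw [show 1 / √|x| = √(1 / |x|) by rw [Real.sqrt_div zero_le_one, Real.sqrt_one]]
      exact Real.sqrt_le_sqrt hb
    have h3 := Real.sqrt_nonneg a
    have e2 : 2 / √|x| = 2 * (1 / √|x|) := by ring
    rw [e2]; linarith
  by_cases hc1 : 1 / |x| ≤ a
  · refine (hhigh' a b ha hc1 hab).trans ?_
    gcongr; norm_num
  by_cases hc2 : b ≤ 1 / |x|
  · refine (hlow a b ha hab hc2).trans ?_
    gcongr; norm_num
  push Not at hc1 hc2
  rw [← intervalIntegral.integral_add_adjacent_intervals (hint t a (1 / |x|) ha hc1.le)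
        (hint t (1 / |x|) b (ha.trans hc1.le) hc2.le)]
  have e : 60 / √|x| = 2 / √|x| + 58 / √|x| := by ring
  rw [e]
  refine (norm_add_le _ _).trans (add_le_add (hlow a _ ha hc1.le le_rfl)
    ((hhigh' _ b (ha.trans hc1.le) le_rfl hc2.le).trans ?_))
  gcongr; norm_num

/-! ### The maximal estimate -/

lemma integrableOn_inv_sqrt_abs (B : ℝ) :
    IntegrableOn (fun u : ℝ => 1 / √|u|) (Icc (-B) B) := by
  rcases le_or_gt B 0 with hB | hB
  · rcases hB.eq_or_lt with rfl | hB
    · simp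
    · rw [Icc_eq_empty (by linarith)]; exact integrableOn_empty
  have h1 : IntervalIntegrable (fun u : ℝ => 1 / √|u|) volume 0 B := by
    refine (intervalIntegral.intervalIntegrable_rpow' (r := -(1 / 2)) (by norm_num)).congr ?_
    intro u hu
    rw [uIoc_of_le hB.le] at hu
    simp only
    rw [abs_of_pos hu.1, Real.rpow_neg hu.1.le, Real.sqrt_eq_rpow, one_div (_ ^ _)]
  have h2 : IntervalIntegrable (fun u : ℝ => 1 / √|u|) volume (-B) 0 := by
    have := (IntervalIntegrable.iff_comp_neg (f := fun u : ℝ => 1 / √|u|)).1 h1.symm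
    simpa using this
  rw [integrableOn_Icc_iff_integrableOn_Ioc]
  exact (intervalIntegrable_iff_integrableOn_Ioc_of_le (by linarith)).1 (h2.trans h1)

/-- This is the Schur bound for the kernel |x-y|^{-1/2}: for x in [-A, A] the differences x - y stay
in [-2A, 2A], so the bound does not depend on x. -/
lemma setIntegral_inv_sqrt_abs_sub_le {A x : ℝ} (hx : x ∈ Icc (-A) A) {E : Set ℝ}
    (hE : E ⊆ Icc (-A) A) (hEm : MeasurableSet E) :
    IntegrableOn (fun y : ℝ => 1 / √|x - y|) E ∧
      ∫ y in E, 1 / √|x - y| ≤ ∫ u in Icc (-(2 * A)) (2 * A), 1 / √|u| := by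
  have hI := integrableOn_inv_sqrt_abs (2 * A)
  have hI' : Integrable ((Icc (-(2 * A)) (2 * A)).indicator fun u : ℝ => 1 / √|u|) :=
    hI.integrable_indicator measurableSet_Icc
  have hI2 := hI'.comp_sub_left x
  have hpos : ∀ u : ℝ, 0 ≤ (Icc (-(2 * A)) (2 * A)).indicator (fun u : ℝ => 1 / √|u|) u :=
    fun u => indicator_nonneg (fun _ _ => by positivity) u
  have heq : ∀ y ∈ E, (Icc (-(2 * A)) (2 * A)).indicator (fun u : ℝ => 1 / √|u|) (x - y)
      = 1 / √|x - y| := by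
    intro y hy
    rw [indicator_of_mem]
    have := hE hy
    exact ⟨by linarith [hx.1, this.2], by linarith [hx.2, this.1]⟩
  constructor
  · exact hI2.integrableOn.congr_fun heq hEm
  · rw [← setIntegral_congr_fun hEm heq]
    refine (setIntegral_le_integral hI2 (Eventually.of_forall fun y => hpos _)).trans ?_
    rw [integral_sub_left_eq_self (fun y => (Icc (-(2 * A)) (2 * A)).indicator
      (fun u : ℝ => 1 / √|u|) y) volume x, integral_indicator measurableSet_Icc]

/-- Cauchy-Schwarz for nonnegative real functions. -/
lemma integral_mul_le_sqrt_mul_sqrt {α : Type*} [MeasurableSpace α] {μ : Measure α} {f g : α → ℝ}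
    (hf : ∀ᵐ x ∂μ, 0 ≤ f x) (hg : ∀ᵐ x ∂μ, 0 ≤ g x) (hfm : MemLp f 2 μ) (hgm : MemLp g 2 μ) :
    ∫ x, f x * g x ∂μ ≤ √(∫ x, f x ^ 2 ∂μ) * √(∫ x, g x ^ 2 ∂μ) := by
  have h2 : ENNReal.ofReal 2 = 2 := by simp
  have := integral_mul_le_Lp_mul_Lq_of_nonneg (μ := μ) Real.HolderConjugate.two_two hf hg
    (by rwa [h2]) (by rwa [h2])
  simpa [Real.sqrt_eq_rpow] using this

/-- The linearized kernel of the maximal operator. -/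
noncomputable def linKernel (T R : ℝ → ℝ) (x ξ : ℝ) : ℂ :=
  if ξ ≤ R x then cis (x * ξ + T x * disp ξ) else 0

lemma norm_linKernel_le (T R : ℝ → ℝ) (x ξ : ℝ) : ‖linKernel T R x ξ‖ ≤ 1 := by
  unfold linKernel; split_ifs <;> simp

lemma measurable_linKernel {T R : ℝ → ℝ} (hT : Measurable T) (hR : Measurable R) :
    Measurable (fun p : ℝ × ℝ => linKernel T R p.1 p.2) := by
  unfold linKernel
  refine Measurable.ite (measurableSet_le measurable_snd (hR.comp measurable_fst)) ?_
    measurable_const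
  apply continuous_cis.measurable.comp
  exact (measurable_fst.mul measurable_snd).add
    ((hT.comp measurable_fst).mul (continuous_disp.measurable.comp measurable_snd))

lemma integral_linKernel_mul {T R : ℝ → ℝ} {N R₀ x : ℝ} (hN : N ≤ R x) (hR : R x ≤ R₀)
    (g : ℝ → ℂ) :
    ∫ ξ in Ioc N R₀, linKernel T R x ξ * g ξ =
      ∫ ξ in N..R x, cis (x * ξ + T x * disp ξ) * g ξ := by
  rw [intervalIntegral.integral_of_le hN, ← inter_eq_self_of_subset_right
    (Ioc_subset_Ioc_right hR : Ioc N (R x) ⊆ Ioc N R₀), ← setIntegral_indicator measurableSet_Ioc]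
  apply setIntegral_congr_fun measurableSet_Ioc
  intro ξ hξ
  simp only [linKernel, indicator, mem_Ioc, hξ.1, true_and]
  split_ifs <;> simp

/-- The product of one linearized kernel with the conjugate of another is again such a kernel, at
the point x - y, with time T(x) - T(y) and the smaller cutoff. The bound uniform in time and window
therefore applies to arbitrary choice functions. -/
lemma norm_integral_linKernel_mul_conj_le {T R : ℝ → ℝ} {N R₀ x y : ℝ} (hN1 : 1 ≤ N)
    (hNR : ∀ x, N ≤ R x) (hR : ∀ x, R x ≤ R₀) (hxy : x ≠ y) :
    ‖∫ ξ in Ioc N R₀, ((ξ ^ (-(1 / 2) : ℝ) : ℝ) : ℂ) *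
      (linKernel T R x ξ * (starRingEnd ℂ) (linKernel T R y ξ))‖ ≤ 60 * (1 / √|x - y|) := by
  have h := integral_linKernel_mul (T := fun _ => T x - T y) (R := fun _ => min (R x) (R y))
    (N := N) (R₀ := R₀) (x := x - y) (le_min (hNR x) (hNR y)) ((min_le_left _ _).trans (hR x))
    (fun ξ => ((ξ ^ (-(1 / 2) : ℝ) : ℝ) : ℂ))
  have e : ∀ ξ, ((ξ ^ (-(1 / 2) : ℝ) : ℝ) : ℂ) *
      (linKernel T R x ξ * (starRingEnd ℂ) (linKernel T R y ξ)) =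
      linKernel (fun _ => T x - T y) (fun _ => min (R x) (R y)) (x - y) ξ *
        ((ξ ^ (-(1 / 2) : ℝ) : ℝ) : ℂ) := by
    intro ξ
    rw [mul_comm]
    congr 1
    unfold linKernel
    by_cases h1 : ξ ≤ R x <;> by_cases h2 : ξ ≤ R y <;> simp [h1, h2, conj_cis]
    rw [← cis_add]; congr 1; ring
  simp only [e]
  rw [h]
  refine (norm_integral_maximal_kernel_le (sub_ne_zero.2 hxy) hN1
    (le_min (hNR x) (hNR y))).trans (le_of_eq (by ring))

set_option maxHeartbeats 1000000 in
/-- The linearized maximal estimate. -/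
lemma integral_norm_linearized_le {A N R₀ : ℝ} (hA : 0 ≤ A) (hN : 1 ≤ N) {g : ℝ → ℂ}
    (hg : Measurable g) (hgI : IntegrableOn (fun ξ => ‖g ξ‖ ^ 2 * √ξ) (Ioi N)) {E : Set ℝ}
    (hE : E ⊆ Icc (-A) A) (hEm : MeasurableSet E) {T R : ℝ → ℝ} (hT : Measurable T)
    (hR : Measurable R) (hNR : ∀ x, N ≤ R x) (hRR : ∀ x, R x ≤ R₀) :
    IntegrableOn (fun x => ∫ ξ in N..R x, cis (x * ξ + T x * disp ξ) * g ξ) E ∧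
    ∫ x in E, ‖∫ ξ in N..R x, cis (x * ξ + T x * disp ξ) * g ξ‖ ≤
      √(∫ ξ in Ioi N, ‖g ξ‖ ^ 2 * √ξ) *
        √(120 * A * ∫ u in Icc (-(2 * A)) (2 * A), 1 / √|u|) := by
  set K : ℝ := ∫ u in Icc (-(2 * A)) (2 * A), 1 / √|u| with hK
  have hK0 : 0 ≤ K := integral_nonneg fun u => by positivity
  set ν := volume.restrict (Ioc N R₀) with hν
  set μ := volume.restrict E with hμ
  have : IsFiniteMeasure μ := by
    constructor
    rw [hμ, Measure.restrict_apply_univ]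
    exact (measure_mono hE).trans_lt (by simp)
  set k := linKernel T R with hk
  have hkm := measurable_linKernel hT hR
  have hk1 := norm_linKernel_le T R
  have hkm1 : ∀ x, Measurable (k x) := fun x => hkm.comp measurable_prodMk_left
  have hmemν : ∀ᵐ ξ ∂ν, ξ ∈ Ioc N R₀ := ae_restrict_mem measurableSet_Ioc
  have hgν2 : Integrable (fun ξ => ‖g ξ‖ ^ 2 * √ξ) ν :=
    hgI.mono_set Ioc_subset_Ioi_self
  -- Here |g| ≤ 1 + |g|²√ξ because √ξ ≥ 1, and the constant 1 is integrable thanks to the uniform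
  -- upper cutoff R₀.
  have hgν : Integrable g ν := by
    refine Integrable.mono' ((integrable_const (1 : ℝ)).add hgν2) hg.aestronglyMeasurable ?_
    filter_upwards [hmemν] with ξ hξ
    have h1 : 1 ≤ √ξ := Real.one_le_sqrt.2 (hN.trans hξ.1.le)
    simp only [Pi.add_apply]
    nlinarith [sq_nonneg (‖g ξ‖ - 1), sq_nonneg ‖g ξ‖, norm_nonneg (g ξ)]
  set u : ℝ → ℂ := fun x => ∫ ξ, k x ξ * g ξ ∂ν with hu
  have hueq : ∀ x, ∫ ξ in N..R x, cis (x * ξ + T x * disp ξ) * g ξ = u x := fun x =>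
    (integral_linKernel_mul (hNR x) (hRR x) g).symm
  simp only [hueq]
  have hkgint : Integrable (fun p : ℝ × ℝ => k p.1 p.2 * g p.2) (μ.prod ν) := by
    refine Integrable.mono (hgν.comp_snd μ) (hkm.mul (hg.comp measurable_snd)).aestronglyMeasurable
      (Eventually.of_forall fun p => ?_)
    rw [norm_mul]
    exact mul_le_of_le_one_left (norm_nonneg _) (hk1 _ _)
  have huI : Integrable u μ := hkgint.integral_prod_left
  refine ⟨huI, ?_⟩
  have hum : Measurable u :=
    ((hkm.mul (hg.comp measurable_snd)).stronglyMeasurable.integral_prod_right').measurable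
  -- The phase w turns the L¹ norm of u into a linear pairing. Where u vanishes, division by zero
  -- gives w = 0, which still satisfies the identity.
  obtain ⟨w, hwm, hw1, hwu⟩ : ∃ w : ℝ → ℂ, Measurable w ∧ (∀ x, ‖w x‖ ≤ 1) ∧
      ∀ x, w x * u x = (‖u x‖ : ℂ) := by
    refine ⟨fun x => (starRingEnd ℂ) (u x) / (‖u x‖ : ℂ), ?_, fun x => ?_, fun x => ?_⟩
    · have : Measurable fun x => (‖u x‖ : ℂ) := Complex.measurable_ofReal.comp hum.norm
      exact (Complex.continuous_conj.measurable.comp hum).div this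
    · simp only [norm_div, RCLike.norm_conj, Complex.norm_real, norm_norm]
      exact div_self_le_one _
    · by_cases h : u x = 0
      · simp [h]
      · have h' : (‖u x‖ : ℂ) ≠ 0 := by simpa using h
        rw [div_mul_eq_mul_div, mul_comm, Complex.mul_conj, Complex.normSq_eq_norm_sq]
        field_simp
        push_cast
        ring
  set G : ℝ → ℂ := fun ξ => ∫ x, w x * k x ξ ∂μ with hG
  have hwkm : Measurable (fun p : ℝ × ℝ => w p.1 * k p.1 p.2) := (hwm.comp measurable_fst).mul hkm
  have hGm : Measurable G := by
    have : Measurable (fun p : ℝ × ℝ => w p.2 * k p.2 p.1) := 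
      (hwm.comp measurable_snd).mul (hkm.comp measurable_swap)
    exact this.stronglyMeasurable.integral_prod_right'.measurable
  have hwk1 : ∀ x ξ, ‖w x * k x ξ‖ ≤ 1 := fun x ξ => by
    rw [norm_mul]; exact mul_le_one₀ (hw1 x) (norm_nonneg _) (hk1 x ξ)
  have hGb : ∀ ξ, ‖G ξ‖ ≤ μ.real univ := by
    intro ξ
    have := norm_integral_le_of_norm_le_const (μ := μ) (f := fun x => w x * k x ξ) (C := 1)
      (Eventually.of_forall fun x => hwk1 x ξ)
    simpa using this
  -- duality
  have hdual : (∫ x, ‖u x‖ ∂μ) ≤ ∫ ξ, ‖g ξ‖ * ‖G ξ‖ ∂ν := by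
    have hwkg : Integrable (fun p : ℝ × ℝ => w p.1 * (k p.1 p.2 * g p.2)) (μ.prod ν) := by
      refine hkgint.mono ((hwm.comp measurable_fst).mul
        (hkm.mul (hg.comp measurable_snd))).aestronglyMeasurable
        (Eventually.of_forall fun p => ?_)
      rw [norm_mul]
      exact mul_le_of_le_one_left (norm_nonneg _) (hw1 p.1)
    have e1 : ((∫ x, ‖u x‖ ∂μ : ℝ) : ℂ) = ∫ ξ, g ξ * G ξ ∂ν := by
      calc ((∫ x, ‖u x‖ ∂μ : ℝ) : ℂ) = ∫ x, ∫ ξ, w x * (k x ξ * g ξ) ∂ν ∂μ := by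
            rw [← integral_complex_ofReal]
            refine integral_congr_ae (Eventually.of_forall fun x => ?_)
            show (‖u x‖ : ℂ) = ∫ ξ, w x * (k x ξ * g ξ) ∂ν
            rw [integral_const_mul]
            exact (hwu x).symm
        _ = ∫ ξ, ∫ x, w x * (k x ξ * g ξ) ∂μ ∂ν := integral_integral_swap hwkg
        _ = ∫ ξ, g ξ * G ξ ∂ν := by
            refine integral_congr_ae (Eventually.of_forall fun ξ => ?_)
            show _ = g ξ * ∫ x, w x * k x ξ ∂μ
            rw [← integral_const_mul]
            exact integral_congr_ae (Eventually.of_forall fun x => by ring)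
    have e2 : (∫ x, ‖u x‖ ∂μ) = ‖∫ ξ, g ξ * G ξ ∂ν‖ := by
      rw [← e1, Complex.norm_real, Real.norm_eq_abs, abs_of_nonneg]
      exact integral_nonneg fun x => norm_nonneg _
    rw [e2]
    refine (norm_integral_le_integral_norm _).trans (le_of_eq ?_)
    simp only [norm_mul]
  set W : ℝ → ℝ := fun ξ => ξ ^ (-(1 / 2) : ℝ) with hW
  have hWm : Measurable W := by simp only [hW]; fun_prop
  have hWs : ∀ ξ, 1 ≤ ξ → W ξ = 1 / √ξ := by
    intro ξ hξ
    simp only [hW]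
    rw [Real.rpow_neg (by linarith), Real.sqrt_eq_rpow]
    exact (one_div _).symm
  have hW1 : ∀ᵐ ξ ∂ν, ‖(W ξ : ℂ)‖ ≤ 1 := by
    filter_upwards [hmemν] with ξ hξ
    have h1 : 1 ≤ √ξ := Real.one_le_sqrt.2 (hN.trans hξ.1.le)
    rw [Complex.norm_real, hWs ξ (hN.trans hξ.1.le), Real.norm_eq_abs, abs_of_nonneg (by positivity)]
    exact div_le_one_of_le₀ h1 (by positivity)
  have hWcm : Measurable fun ξ => (W ξ : ℂ) := Complex.measurable_ofReal.comp hWm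
  -- the square function is controlled by the kernel
  have hTT : ∫ ξ, W ξ * ‖G ξ‖ ^ 2 ∂ν ≤ 120 * A * K := by
    have e1 : ((∫ ξ, W ξ * ‖G ξ‖ ^ 2 ∂ν : ℝ) : ℂ) =
        ∫ x, w x * ∫ y, (starRingEnd ℂ) (w y) *
          ∫ ξ, (W ξ : ℂ) * (k x ξ * (starRingEnd ℂ) (k y ξ)) ∂ν ∂μ ∂μ := by
      have hWμ : ∀ᵐ p ∂(μ.prod ν), ‖(W p.2 : ℂ)‖ ≤ 1 :=
        Measure.quasiMeasurePreserving_snd.ae hW1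
      have i1 : ∀ x, Integrable (fun p : ℝ × ℝ => (starRingEnd ℂ) (w p.1) *
          ((W p.2 : ℂ) * (k x p.2 * (starRingEnd ℂ) (k p.1 p.2)))) (μ.prod ν) := by
        intro x
        refine Integrable.of_bound (C := 1) ?_ ?_
        · apply Measurable.aestronglyMeasurable
          refine (Complex.continuous_conj.measurable.comp (hwm.comp measurable_fst)).mul ?_
          exact (hWcm.comp measurable_snd).mul (((hkm1 x).comp measurable_snd).mul
            (Complex.continuous_conj.measurable.comp hkm))
        · filter_upwards [hWμ] with p hp
          simp only [norm_mul, RCLike.norm_conj] at hp ⊢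
          exact mul_le_one₀ (hw1 _) (by positivity) (mul_le_one₀ hp (by positivity)
            (mul_le_one₀ (hk1 _ _) (by positivity) (hk1 _ _)))
      have i2 : Integrable (fun p : ℝ × ℝ => w p.1 *
          ((W p.2 : ℂ) * k p.1 p.2 * (starRingEnd ℂ) (G p.2))) (μ.prod ν) := by
        refine Integrable.of_bound (C := μ.real univ) ?_ ?_
        · apply Measurable.aestronglyMeasurable
          refine (hwm.comp measurable_fst).mul (((hWcm.comp measurable_snd).mul hkm).mul ?_)
          exact Complex.continuous_conj.measurable.comp (hGm.comp measurable_snd)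
        · filter_upwards [hWμ] with p hp
          simp only [norm_mul, RCLike.norm_conj] at hp ⊢
          have h1 := mul_le_one₀ hp (norm_nonneg _) (hk1 p.1 p.2)
          have h2 := mul_le_one₀ (hw1 p.1) (by positivity) h1
          calc _ = ‖w p.1‖ * (‖(W p.2 : ℂ)‖ * ‖k p.1 p.2‖) * ‖G p.2‖ := by ring
            _ ≤ 1 * μ.real univ := mul_le_mul h2 (hGb _) (norm_nonneg _) zero_le_one
            _ = _ := one_mul _
      have s1 : ∀ x, (∫ y, (starRingEnd ℂ) (w y) *
          ∫ ξ, (W ξ : ℂ) * (k x ξ * (starRingEnd ℂ) (k y ξ)) ∂ν ∂μ) =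
          ∫ ξ, (W ξ : ℂ) * k x ξ * (starRingEnd ℂ) (G ξ) ∂ν := by
        intro x
        calc _ = ∫ y, ∫ ξ, (starRingEnd ℂ) (w y) *
              ((W ξ : ℂ) * (k x ξ * (starRingEnd ℂ) (k y ξ))) ∂ν ∂μ :=
              integral_congr_ae (Eventually.of_forall fun y => (integral_const_mul _ _).symm)
          _ = ∫ ξ, ∫ y, (starRingEnd ℂ) (w y) *
              ((W ξ : ℂ) * (k x ξ * (starRingEnd ℂ) (k y ξ))) ∂μ ∂ν :=
              integral_integral_swap (i1 x)
          _ = _ := by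
              refine integral_congr_ae (Eventually.of_forall fun ξ => ?_)
              show _ = (W ξ : ℂ) * k x ξ * (starRingEnd ℂ) (∫ y, w y * k y ξ ∂μ)
              rw [← integral_conj, ← integral_const_mul]
              refine integral_congr_ae (Eventually.of_forall fun y => ?_)
              simp only [map_mul]; ring
      symm
      calc _ = ∫ x, ∫ ξ, w x * ((W ξ : ℂ) * k x ξ * (starRingEnd ℂ) (G ξ)) ∂ν ∂μ := by
            refine integral_congr_ae (Eventually.of_forall fun x => ?_)
            simp only [s1 x, integral_const_mul]
        _ = ∫ ξ, ∫ x, w x * ((W ξ : ℂ) * k x ξ * (starRingEnd ℂ) (G ξ)) ∂μ ∂ν :=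
            integral_integral_swap i2
        _ = ∫ ξ, ((W ξ * ‖G ξ‖ ^ 2 : ℝ) : ℂ) ∂ν := by
            refine integral_congr_ae (Eventually.of_forall fun ξ => ?_)
            have h1 : ∀ x, w x * ((W ξ : ℂ) * k x ξ * (starRingEnd ℂ) (G ξ)) =
                ((W ξ : ℂ) * (starRingEnd ℂ) (G ξ)) * (w x * k x ξ) := fun x => by ring
            simp only [h1, integral_const_mul]
            show (W ξ : ℂ) * (starRingEnd ℂ) (G ξ) * G ξ = _
            push_cast
            rw [← Complex.conj_mul']
            ring
        _ = _ := integral_complex_ofReal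
    have e2 : (∫ ξ, W ξ * ‖G ξ‖ ^ 2 ∂ν) ≤ ‖((∫ ξ, W ξ * ‖G ξ‖ ^ 2 ∂ν : ℝ) : ℂ)‖ := by
      rw [Complex.norm_real]; exact le_abs_self _
    refine e2.trans ?_
    rw [e1]
    have hinner : ∀ᵐ x ∂μ, ‖w x * ∫ y, (starRingEnd ℂ) (w y) *
          ∫ ξ, (W ξ : ℂ) * (k x ξ * (starRingEnd ℂ) (k y ξ)) ∂ν ∂μ‖ ≤ 60 * K := by
      filter_upwards [ae_restrict_mem hEm] with x hx
      rw [norm_mul]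
      refine (mul_le_of_le_one_left (norm_nonneg _) (hw1 x)).trans ?_
      have hs := setIntegral_inv_sqrt_abs_sub_le (hE hx) hE hEm
      refine (norm_integral_le_of_norm_le (hs.1.const_mul 60) ?_).trans ?_
      · have hne : ∀ᵐ y ∂μ, y ≠ x := by
          refine ae_restrict_of_ae ?_
          simp [ae_iff]
        filter_upwards [hne] with y hy
        rw [norm_mul, RCLike.norm_conj]
        refine (mul_le_of_le_one_left (norm_nonneg _) (hw1 y)).trans ?_
        exact norm_integral_linKernel_mul_conj_le hN hNR hRR hy.symm
      · rw [integral_const_mul]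
        exact mul_le_mul_of_nonneg_left hs.2 (by norm_num)
    refine (norm_integral_le_of_norm_le_const hinner).trans ?_
    have hμA : μ.real univ ≤ 2 * A := by
      rw [hμ, measureReal_restrict_apply_univ]
      refine (measureReal_mono hE (by simp)).trans ?_
      rw [measureReal_def, Real.volume_Icc, ENNReal.toReal_ofReal (by linarith)]
      linarith
    calc 60 * K * μ.real univ ≤ 60 * K * (2 * A) := by gcongr
      _ = _ := by ring
  -- Cauchy–Schwarz with the weight ξ^{1/4} on g and ξ^{-1/4} on G: squaring produces the H^{1/4}
  -- weight √ξ and the kernel amplitude ξ^{-1/2}.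
  have hcs := integral_mul_le_sqrt_mul_sqrt (μ := ν) (f := fun ξ => ‖g ξ‖ * √(√ξ))
    (g := fun ξ => ‖G ξ‖ / √(√ξ)) (Eventually.of_forall fun ξ => by positivity)
    (Eventually.of_forall fun ξ => by positivity)
    (by
      rw [memLp_two_iff_integrable_sq (by fun_prop)]
      refine hgν2.congr (Eventually.of_forall fun ξ => ?_)
      simp only [mul_pow, Real.sq_sqrt (Real.sqrt_nonneg ξ)])
    (by
      refine MemLp.of_bound (hGm.norm.div (by fun_prop)).aestronglyMeasurable (μ.real univ) ?_
      filter_upwards [hmemν] with ξ hξ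
      have h1 : 1 ≤ √√ξ := Real.one_le_sqrt.2 (Real.one_le_sqrt.2 (hN.trans hξ.1.le))
      rw [Real.norm_eq_abs, abs_of_nonneg (by positivity)]
      exact (div_le_self (norm_nonneg _) h1).trans (hGb ξ))
  have c1 : ∫ ξ, ‖g ξ‖ * ‖G ξ‖ ∂ν = ∫ ξ, ‖g ξ‖ * √(√ξ) * (‖G ξ‖ / √(√ξ)) ∂ν := by
    apply integral_congr_ae
    filter_upwards [hmemν] with ξ hξ
    have h1 : 1 ≤ √√ξ := Real.one_le_sqrt.2 (Real.one_le_sqrt.2 (hN.trans hξ.1.le))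
    field_simp
  have c2 : ∫ ξ, (‖g ξ‖ * √(√ξ)) ^ 2 ∂ν ≤ ∫ ξ in Ioi N, ‖g ξ‖ ^ 2 * √ξ := by
    simp only [mul_pow, Real.sq_sqrt (Real.sqrt_nonneg _)]
    exact setIntegral_mono_set hgI (Eventually.of_forall fun ξ => by positivity)
      (LE.le.eventuallyLE Ioc_subset_Ioi_self)
  have c3 : ∫ ξ, (‖G ξ‖ / √(√ξ)) ^ 2 ∂ν = ∫ ξ, W ξ * ‖G ξ‖ ^ 2 ∂ν := by
    apply integral_congr_ae
    filter_upwards [hmemν] with ξ hξ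
    rw [hWs ξ (hN.trans hξ.1.le), div_pow, Real.sq_sqrt (Real.sqrt_nonneg ξ)]
    ring
  refine hdual.trans ?_
  rw [c1]
  refine hcs.trans ?_
  rw [c3]
  gcongr

lemma intervalIntegrable_cis_mul {g : ℝ → ℂ} (hg : LocallyIntegrable g) {F : ℝ → ℝ}
    (hF : Continuous F) (a b : ℝ) :
    IntervalIntegrable (fun ξ => cis (F ξ) * g ξ) volume a b := by
  have h : IntervalIntegrable g volume a b :=
    (hg.integrableOn_isCompact isCompact_uIcc).intervalIntegrable
  exact h.continuousOn_mul (continuous_cis.comp hF).continuousOn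

/-- Joint continuity allows the supremum over times and cutoffs to be taken over a countable dense
set. -/
lemma continuous_windowIntegral {g : ℝ → ℂ} (hg : LocallyIntegrable g) (N : ℝ) :
    Continuous (fun p : (ℝ × ℝ) × ℝ =>
      ∫ ξ in N..p.2, cis (p.1.1 * ξ + p.1.2 * disp ξ) * g ξ) := by
  rw [continuous_iff_continuousAt]
  rintro ⟨x₀, b₀⟩
  have hi : ∀ a b, IntervalIntegrable g volume a b := fun a b =>
    (hg.integrableOn_isCompact isCompact_uIcc).intervalIntegrable
  refine intervalIntegral.continuousAt_parametric_primitive_of_dominated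
    (F := fun (q : ℝ × ℝ) ξ => cis (q.1 * ξ + q.2 * disp ξ) * g ξ) (fun ξ => ‖g ξ‖)
    (min N b₀ - 1) (max N b₀ + 1) (fun q => ?_) ?_ (hi _ _).norm ?_ ?_ ?_ (by simp)
  · exact ((intervalIntegrable_cis_mul hg (by fun_prop) _ _).def').aestronglyMeasurable
  · exact Eventually.of_forall fun q => Eventually.of_forall fun ξ => by simp
  · refine Eventually.of_forall fun ξ => ?_
    have : Continuous (fun q : ℝ × ℝ => cis (q.1 * ξ + q.2 * disp ξ) * g ξ) := by fun_prop
    exact this.continuousAt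
  · exact ⟨by linarith [min_le_left N b₀], by linarith [le_max_left N b₀]⟩
  · exact ⟨by linarith [min_le_right N b₀], by linarith [le_max_right N b₀]⟩

/-- The weak type estimate for the maximal operator over times and frequency windows. -/
lemma volume_maximal_gt_le {A N l : ℝ} (hA : 0 ≤ A) (hN : 1 ≤ N) (hl : 0 < l) {g : ℝ → ℂ}
    (hg : Measurable g) (hgl : LocallyIntegrable g)
    (hgI : IntegrableOn (fun ξ => ‖g ξ‖ ^ 2 * √ξ) (Ioi N)) :
    volume {x ∈ Icc (-A) A | ∃ t R, N ≤ R ∧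
        l < ‖∫ ξ in N..R, cis (x * ξ + t * disp ξ) * g ξ‖} ≤
      ENNReal.ofReal (√(∫ ξ in Ioi N, ‖g ξ‖ ^ 2 * √ξ) *
        √(120 * A * ∫ u in Icc (-(2 * A)) (2 * A), 1 / √|u|) / l) := by
  set c := √(∫ ξ in Ioi N, ‖g ξ‖ ^ 2 * √ξ) *
        √(120 * A * ∫ u in Icc (-(2 * A)) (2 * A), 1 / √|u|) with hc
  set S : ℝ × ℝ → ℝ → ℂ := fun q x => ∫ ξ in N..max N q.2, cis (x * ξ + q.1 * disp ξ) * g ξ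
    with hS
  have hcont : Continuous (fun p : (ℝ × ℝ) × ℝ => S p.1 p.2) := by
    exact (continuous_windowIntegral hgl N).comp
      (g := fun p : (ℝ × ℝ) × ℝ => ∫ ξ in N..p.2, cis (p.1.1 * ξ + p.1.2 * disp ξ) * g ξ)
      (f := fun p : (ℝ × ℝ) × ℝ => ((p.2, p.1.1), max N p.1.2)) (by fun_prop)
  set q := TopologicalSpace.denseSeq (ℝ × ℝ) with hq
  set P : ℕ → ℝ → Prop := fun k x => l < ‖S (q k) x‖ with hP
  have hPm : ∀ k, MeasurableSet {x | P k x} := fun k => by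
    have : Continuous fun x => S (q k) x := hcont.comp (Continuous.prodMk_right (q k))
    exact measurableSet_lt measurable_const this.norm.measurable
  set E : ℕ → Set ℝ := fun n => Icc (-A) A ∩ ⋃ k ∈ Finset.range (n + 1), {x | P k x} with hE
  have hEm : ∀ n, MeasurableSet (E n) := fun n =>
    measurableSet_Icc.inter (Finset.measurableSet_biUnion _ fun k _ => hPm k)
  have hEmono : Monotone E := by
    intro m n hmn
    refine inter_subset_inter_right _ (biUnion_subset_biUnion_left fun k hk => ?_)
    simp only [Finset.coe_range, Set.mem_Iio] at hk ⊢
    omega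
  have hsub : {x ∈ Icc (-A) A | ∃ t R, N ≤ R ∧
        l < ‖∫ ξ in N..R, cis (x * ξ + t * disp ξ) * g ξ‖} ⊆ ⋃ n, E n := by
    rintro x ⟨hx, t, R, hR, hlt⟩
    have hopen : IsOpen {p : ℝ × ℝ | l < ‖S p x‖} :=
      isOpen_lt continuous_const (hcont.comp (Continuous.prodMk_left x)).norm
    obtain ⟨k, hk⟩ := (TopologicalSpace.denseRange_denseSeq (ℝ × ℝ)).exists_mem_open hopen
      ⟨(t, R), by simpa [hS, max_eq_right hR] using hlt⟩
    refine mem_iUnion.2 ⟨k, hx, ?_⟩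
    simp only [mem_iUnion]
    exact ⟨k, by simp, hk⟩
  refine (measure_mono hsub).trans ?_
  rw [hEmono.measure_iUnion]
  refine iSup_le fun n => ?_
  -- The alternative n < k makes the search total with values at most n + 1. The choice of time and
  -- cutoff is thus measurable with finitely many values; on `E n` the search stops at an index
  -- where `P` holds.
  have hfind : ∀ x, ∃ k, P k x ∨ n < k := fun x => ⟨n + 1, Or.inr (Nat.lt_succ_self n)⟩
  classical
  set ι : ℝ → ℕ := fun x => Nat.find (hfind x) with hι
  have hιm : Measurable ι := measurable_find hfind fun k =>
    (hPm k).union (MeasurableSet.const _)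
  have hιle : ∀ x, ι x ≤ n + 1 := fun x => Nat.find_min' _ (Or.inr (Nat.lt_succ_self n))
  have hιE : ∀ x ∈ E n, P (ι x) x := by
    rintro x ⟨_, hx⟩
    simp only [mem_iUnion] at hx
    obtain ⟨k, hk, hkx⟩ := hx
    have hk' := Finset.mem_range.1 hk
    have h1 : ι x ≤ k := Nat.find_min' _ (Or.inl hkx)
    rcases Nat.find_spec (hfind x) with h | h
    · exact h
    · change n < ι x at h; omega
  obtain ⟨R₀, hR₀⟩ : ∃ R₀, ∀ x, max N (q (ι x)).2 ≤ R₀ := by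
    obtain ⟨R₀, hR₀⟩ := ((Finset.range (n + 2)).image fun k => max N (q k).2).bddAbove
    refine ⟨R₀, fun x => hR₀ ?_⟩
    rw [Finset.coe_image]
    exact ⟨ι x, by have := hιle x; simp; omega, rfl⟩
  have key := integral_norm_linearized_le (E := E n) (T := fun x => (q (ι x)).1)
    (R := fun x => max N (q (ι x)).2) (R₀ := R₀) hA hN hg hgI inter_subset_left (hEm n)
    ((measurable_from_nat (f := fun k => (q k).1)).comp hιm)
    ((measurable_from_nat (f := fun k => max N (q k).2)).comp hιm)
    (fun x => le_max_left _ _) hR₀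
  have hfin : volume (E n) ≠ ∞ :=
    ((measure_mono inter_subset_left).trans_lt (by simp : volume (Icc (-A) A) < ∞)).ne
  have h1 : l * volume.real (E n) ≤ c := by
    refine le_trans ?_ key.2
    have h2 := setIntegral_mono_on (μ := volume) (integrableOn_const (C := l) hfin) key.1.norm
      (hEm n) (fun x hx => (hιE x hx).le)
    rw [setIntegral_const, smul_eq_mul, mul_comm] at h2
    exact h2
  rw [← ENNReal.ofReal_toReal hfin]
  apply ENNReal.ofReal_le_ofReal
  rw [le_div_iff₀ hl, mul_comm]
  exact h1

/-- For almost every `x` the high frequency part of the integral is small, uniformly in time. -/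
lemma ae_uniform_small_tail {g : ℝ → ℂ} (hg : Measurable g) (hgl : LocallyIntegrable g)
    (hgI : IntegrableOn (fun ξ => ‖g ξ‖ ^ 2 * √ξ) (Ioi 1)) :
    ∀ᵐ x : ℝ, ∀ ε > 0, ∃ N : ℕ, ∀ n ≥ N, ∀ t R, (n + 1 : ℝ) ≤ R →
      ‖∫ ξ in (n + 1 : ℝ)..R, cis (x * ξ + t * disp ξ) * g ξ‖ ≤ ε := by
  have hN1 : ∀ N : ℕ, (1 : ℝ) ≤ N + 1 := fun N => by
    have : (0 : ℝ) ≤ N := Nat.cast_nonneg N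
    linarith
  have htail : Tendsto (fun N : ℕ => ∫ ξ in Ioi (N + 1 : ℝ), ‖g ξ‖ ^ 2 * √ξ) atTop (𝓝 0) := by
    have h := tendsto_setIntegral_of_antitone (μ := volume) (f := fun ξ => ‖g ξ‖ ^ 2 * √ξ)
      (s := fun N : ℕ => Ioi (N + 1 : ℝ)) (fun _ => measurableSet_Ioi)
      (fun m n hmn => Ioi_subset_Ioi (by simpa using hmn)) ⟨0, by simpa using hgI⟩
    have he : (⋂ N : ℕ, Ioi (N + 1 : ℝ)) = ∅ := by
      ext x
      simp only [mem_iInter, mem_Ioi, mem_empty_iff_false, iff_false, not_forall, not_lt]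
      obtain ⟨n, hn⟩ := exists_nat_ge x
      exact ⟨n, by linarith⟩
    rwa [he, Measure.restrict_empty, integral_zero_measure] at h
  have hnull : ∀ m j : ℕ, volume {x ∈ Icc (-(m : ℝ)) m | ∀ N : ℕ, ∃ t R, (N + 1 : ℝ) ≤ R ∧
      1 / (j + 1 : ℝ) < ‖∫ ξ in (N + 1 : ℝ)..R, cis (x * ξ + t * disp ξ) * g ξ‖} = 0 := by
    intro m j
    set c := √(120 * m * ∫ u in Icc (-(2 * (m : ℝ))) (2 * m), 1 / √|u|) with hc
    have hlim : Tendsto (fun N : ℕ => ENNReal.ofReal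
        (√(∫ ξ in Ioi (N + 1 : ℝ), ‖g ξ‖ ^ 2 * √ξ) * c / (1 / (j + 1 : ℝ)))) atTop (𝓝 0) := by
      have h := (htail.sqrt.mul_const c).div_const (1 / (j + 1 : ℝ))
      have h' := ENNReal.tendsto_ofReal h
      simpa using h'
    refine le_antisymm (ge_of_tendsto' hlim fun N => ?_) (zero_le)
    refine (measure_mono ?_).trans (volume_maximal_gt_le (Nat.cast_nonneg m) (hN1 N)
      (by positivity) hg hgl (hgI.mono_set (Ioi_subset_Ioi (hN1 N))))
    rintro x ⟨hx, h⟩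
    exact ⟨hx, h N⟩
  have hae : ∀ᵐ x : ℝ, ∀ m j : ℕ, ¬ (x ∈ Icc (-(m : ℝ)) m ∧ ∀ N : ℕ, ∃ t R, (N + 1 : ℝ) ≤ R ∧
      1 / (j + 1 : ℝ) < ‖∫ ξ in (N + 1 : ℝ)..R, cis (x * ξ + t * disp ξ) * g ξ‖) := by
    rw [ae_all_iff]; intro m
    rw [ae_all_iff]; intro j
    rw [ae_iff]
    simpa [and_assoc] using hnull m j
  filter_upwards [hae] with x hx ε hε
  obtain ⟨m, hm⟩ := exists_nat_ge |x|
  -- Half of ε suffices for windows starting at N + 1; a window starting at a later n + 1 is a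
  -- difference of two of these.
  obtain ⟨j, hj⟩ := exists_nat_one_div_lt (half_pos hε)
  have h := hx m j
  push Not at h
  obtain ⟨N, hN⟩ := h (abs_le.1 hm)
  refine ⟨N, fun n hn t R hR => ?_⟩
  have hi := fun a b => intervalIntegrable_cis_mul hgl
    (F := fun ξ => x * ξ + t * disp ξ) (by fun_prop) a b
  have hn' : (N + 1 : ℝ) ≤ n + 1 := by
    have : (N : ℝ) ≤ n := by exact_mod_cast hn
    linarith
  have e := intervalIntegral.integral_interval_sub_left (hi (N + 1) R) (hi (N + 1) (n + 1))
  rw [← e]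
  calc _ ≤ ‖_‖ + ‖_‖ := norm_sub_le _ _
    _ ≤ 1 / (j + 1 : ℝ) + 1 / (j + 1 : ℝ) := add_le_add (hN t R (hn'.trans hR)) (hN t _ hn')
    _ ≤ ε := by linarith

/-! ### The L² Fourier transform and the Sobolev space on the frequency side -/

/-- Smooth compactly supported functions are Schwartz and separate locally integrable functions.
This converts identities of tempered distributions, through which the Fourier transform and `MemHs`
are accessed, into almost everywhere identities. -/
lemma ae_eq_of_forall_schwartz {u v : ℝ → ℂ} (hu : LocallyIntegrable u) (hv : LocallyIntegrable v)
    (h : ∀ φ : 𝓢(ℝ, ℂ), ∫ x, φ x * u x = ∫ x, φ x * v x) : u =ᵐ[volume] v := by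
  refine ae_eq_of_integral_contDiff_smul_eq hu hv fun g hg hgc => ?_
  have hc : HasCompactSupport (fun x => (g x : ℂ)) := hgc.comp_left (g := fun x : ℝ => (x : ℂ)) rfl
  have hs : ContDiff ℝ (⊤ : ℕ∞) (fun x => (g x : ℂ)) := Complex.ofRealCLM.contDiff.comp hg
  simpa using h (hc.toSchwartzMap hs)

lemma Lp_locallyIntegrable (f : Lp ℂ 2 (volume : Measure ℝ)) : LocallyIntegrable f :=
  (Lp.memLp f).locallyIntegrable (by norm_num)

lemma toTemperedDistribution_apply_mul (f : Lp ℂ 2 (volume : Measure ℝ)) (φ : 𝓢(ℝ, ℂ)) :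
    (f : 𝓢'(ℝ, ℂ)) φ = ∫ x, φ x * f x := by
  rw [Lp.toTemperedDistribution_apply]; rfl

lemma schwartz_fourierInv_apply (φ : 𝓢(ℝ, ℂ)) (w : ℝ) :
    (𝓕⁻ φ : 𝓢(ℝ, ℂ)) w = ∫ y, cis (2 * Real.pi * (y * w)) * φ y := by
  rw [SchwartzMap.fourierInv_coe, Real.fourierInv_eq']
  refine integral_congr_ae (Eventually.of_forall fun y => ?_)
  simp only [cis, smul_eq_mul, RCLike.inner_apply, conj_trivial]
  congr 2; push_cast; ring

lemma schwartz_fourier_apply (φ : 𝓢(ℝ, ℂ)) (w : ℝ) :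
    (𝓕 φ : 𝓢(ℝ, ℂ)) w = ∫ y, cis (-(2 * Real.pi * (y * w))) * φ y := by
  rw [SchwartzMap.fourier_coe, Real.fourier_eq']
  refine integral_congr_ae (Eventually.of_forall fun y => ?_)
  simp only [cis, smul_eq_mul, RCLike.inner_apply, conj_trivial]
  congr 2; push_cast; ring

/-- On `L¹ ∩ L²` the inverse Fourier transform is given by the integral formula. -/
lemma fourierInv_toLp_ae_eq {h : ℝ → ℂ} (h1 : Integrable h) (h2 : MemLp h 2) :
    ((𝓕⁻ (h2.toLp h) : Lp ℂ 2 (volume : Measure ℝ)) : ℝ → ℂ) =ᵐ[volume]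
      fun x => ∫ w, cis (2 * Real.pi * (x * w)) * h w := by
  have hcont : Continuous fun x => ∫ w, cis (2 * Real.pi * (x * w)) * h w := by
    refine continuous_of_dominated (bound := fun w => ‖h w‖) (fun x => ?_) (fun x => ?_) h1.norm ?_
    · exact (Continuous.aestronglyMeasurable (by fun_prop)).mul h1.aestronglyMeasurable
    · exact Eventually.of_forall fun w => by simp
    · exact Eventually.of_forall fun w => by fun_prop
  refine ae_eq_of_forall_schwartz (Lp_locallyIntegrable _) hcont.locallyIntegrable fun φ => ?_
  rw [← toTemperedDistribution_apply_mul, ← Lp.fourierInv_toTemperedDistribution_eq,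
    TemperedDistribution.fourierInv_apply, toTemperedDistribution_apply_mul]
  have hφ : Integrable φ := φ.integrable
  have hprod : Integrable (fun p : ℝ × ℝ => cis (2 * Real.pi * (p.2 * p.1)) * φ p.2 * h p.1)
      (volume.prod volume) := by
    have hp : Integrable (fun p : ℝ × ℝ => h p.1 * φ p.2) (volume.prod volume) := h1.mul_prod hφ
    refine hp.mono ?_ (Eventually.of_forall fun p => ?_)
    · have : (fun p : ℝ × ℝ => cis (2 * Real.pi * (p.2 * p.1)) * φ p.2 * h p.1) =
          fun p : ℝ × ℝ => cis (2 * Real.pi * (p.2 * p.1)) * (h p.1 * φ p.2) := by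
        ext p; ring
      rw [this]
      exact (Continuous.aestronglyMeasurable (by fun_prop)).mul hp.aestronglyMeasurable
    · simp [mul_comm]
  calc ∫ w, (𝓕⁻ φ : 𝓢(ℝ, ℂ)) w * (h2.toLp h) w
      = ∫ w, ∫ y, cis (2 * Real.pi * (y * w)) * φ y * h w := by
        refine integral_congr_ae ?_
        filter_upwards [h2.coeFn_toLp] with w hw
        rw [hw, schwartz_fourierInv_apply, integral_mul_const]
    _ = ∫ y, ∫ w, cis (2 * Real.pi * (y * w)) * φ y * h w := integral_integral_swap hprod
    _ = _ := by
        refine integral_congr_ae (Eventually.of_forall fun y => ?_)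
        simp only [← integral_const_mul]
        refine integral_congr_ae (Eventually.of_forall fun w => ?_)
        ring

/-- The frequency side description of the Sobolev space. -/
lemma MemHs.memLp_fourier {s : ℝ} {f : Lp ℂ 2 (volume : Measure ℝ)} (hf : MemHs s f) :
    MemLp (fun w : ℝ => (((1 + w ^ 2) ^ (s / 2) : ℝ) : ℂ) *
      (𝓕 f : Lp ℂ 2 (volume : Measure ℝ)) w) 2 := by
  obtain ⟨f', hf'⟩ := TemperedDistribution.memSobolev_iff_exists_smulLeftCLM_fourier.1 hf
  refine (memLp_congr_ae ?_).1 (Lp.memLp f')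
  have hcont : Continuous fun w : ℝ => (((1 + w ^ 2) ^ (s / 2) : ℝ) : ℂ) := by
    refine Complex.continuous_ofReal.comp ?_
    exact Continuous.rpow_const (by fun_prop) fun w => Or.inl (by positivity)
  refine ae_eq_of_forall_schwartz (Lp_locallyIntegrable _) ?_ fun φ => ?_
  · exact locallyIntegrableOn_univ.1 ((locallyIntegrableOn_univ.2
      (Lp_locallyIntegrable _)).continuousOn_mul hcont.continuousOn isOpen_univ.isLocallyClosed)
  · rw [← toTemperedDistribution_apply_mul, ← hf', Lp.fourier_toTemperedDistribution_eq,
      TemperedDistribution.smulLeftCLM_apply_apply, toTemperedDistribution_apply_mul]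
    refine integral_congr_ae (Eventually.of_forall fun w => ?_)
    simp only
    rw [SchwartzMap.smulLeftCLM_apply_apply (by fun_prop)]
    simp only [Real.norm_eq_abs, sq_abs, smul_eq_mul]
    ring

lemma measurable_angularFourier (f : Lp ℂ 2 (volume : Measure ℝ)) :
    Measurable (angularFourier f) :=
  (Lp.stronglyMeasurable _).measurable.comp (measurable_id.div_const _)

lemma integrable_sq_angularFourier (f : Lp ℂ 2 (volume : Measure ℝ)) :
    Integrable (fun ξ => ‖angularFourier f ξ‖ ^ 2) := by
  have h := (memLp_two_iff_integrable_sq_norm (Lp.aestronglyMeasurable _)).1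
    (Lp.memLp (𝓕 f : Lp ℂ 2 (volume : Measure ℝ)))
  exact h.comp_div (R := 2 * Real.pi) (by positivity)

lemma memLp_angularFourier (f : Lp ℂ 2 (volume : Measure ℝ)) : MemLp (angularFourier f) 2 :=
  (memLp_two_iff_integrable_sq_norm (measurable_angularFourier f).aestronglyMeasurable).2
    (integrable_sq_angularFourier f)

lemma locallyIntegrable_angularFourier (f : Lp ℂ 2 (volume : Measure ℝ)) :
    LocallyIntegrable (angularFourier f) :=
  (memLp_angularFourier f).locallyIntegrable (by norm_num)

/-- This is where the index 1/4 enters part (i): √|ξ| is at most a constant times (1 + w²)^{1/4}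
with w = ξ/2π, and s ≥ 1/4 makes that at most (1 + w²)^s. -/
lemma MemHs.integrable_sq_mul_sqrt {s : ℝ} (hs : 1 / 4 ≤ s) {f : Lp ℂ 2 (volume : Measure ℝ)}
    (hf : MemHs s f) : Integrable (fun ξ => ‖angularFourier f ξ‖ ^ 2 * √|ξ|) := by
  have hm := hf.memLp_fourier
  have h := (memLp_two_iff_integrable_sq_norm hm.aestronglyMeasurable).1 hm
  have h2 := (h.comp_div (R := 2 * Real.pi) (by positivity)).const_mul (√(2 * Real.pi))
  refine h2.mono' ?_ (Eventually.of_forall fun ξ => ?_)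
  · exact (((measurable_angularFourier f).norm.pow_const 2).mul (by fun_prop)).aestronglyMeasurable
  · rw [Real.norm_eq_abs, abs_of_nonneg (by positivity)]
    simp only [norm_mul, Complex.norm_real, Real.norm_eq_abs]
    set w := ξ / (2 * Real.pi) with hw
    have hξ : ξ = 2 * Real.pi * w := by rw [hw]; field_simp
    have h1 : 1 ≤ 1 + w ^ 2 := by nlinarith [sq_nonneg w]
    have h3 : √|ξ| ≤ √(2 * Real.pi) * (1 + w ^ 2) ^ s := by
      have hab : |ξ| = 2 * Real.pi * |w| := by
        rw [hξ, abs_mul, abs_of_pos (by positivity)]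
      rw [hab, Real.sqrt_mul (by positivity)]
      gcongr
      have h4 : (1 + w ^ 2) ^ (1 / 4 : ℝ) ≤ (1 + w ^ 2) ^ s :=
        Real.rpow_le_rpow_of_exponent_le h1 hs
      refine le_trans ?_ h4
      have h5 : |w| ≤ √(1 + w ^ 2) := by
        rw [← Real.sqrt_sq_eq_abs]; exact Real.sqrt_le_sqrt (by linarith)
      refine (Real.sqrt_le_sqrt h5).trans (le_of_eq ?_)
      rw [Real.sqrt_eq_rpow, Real.sqrt_eq_rpow, ← Real.rpow_mul (by positivity)]
      norm_num
    have h6 : |(1 + w ^ 2) ^ (s / 2)| ^ 2 = (1 + w ^ 2) ^ s := by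
      rw [sq_abs, ← Real.rpow_natCast, ← Real.rpow_mul (by positivity)]
      congr 1; push_cast; ring
    rw [mul_pow, h6]
    have h7 : angularFourier f ξ = (𝓕 f : Lp ℂ 2 (volume : Measure ℝ)) w := rfl
    rw [h7]
    nlinarith [mul_le_mul_of_nonneg_left h3
      (sq_nonneg ‖(𝓕 f : Lp ℂ 2 (volume : Measure ℝ)) w‖)]

/-! ### Almost everywhere convergence -/

lemma boussinesqPartial_eq (f : Lp ℂ 2 (volume : Measure ℝ)) (R t x : ℝ) :
    boussinesqPartial f R t x = (2 * (Real.pi : ℂ))⁻¹ *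
      ∫ ξ in (-R)..R, cis (x * ξ + t * disp ξ) * angularFourier f ξ := by
  unfold boussinesqPartial
  congr 1
  refine intervalIntegral.integral_congr fun ξ _ => ?_
  simp only [cis_add]
  rfl

/-- The partial integrals of a function in `H^{1/4}` converge uniformly in time, almost
everywhere. -/
lemma ae_uniform_boussinesqPartial {s : ℝ} (hs : 1 / 4 ≤ s) {f : Lp ℂ 2 (volume : Measure ℝ)}
    (hf : MemHs s f) : ∀ᵐ x : ℝ, ∀ ε > 0, ∃ N : ℕ, ∀ n ≥ N, ∀ t R, (n + 1 : ℝ) ≤ R →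
      ‖boussinesqPartial f R t x - boussinesqPartial f (n + 1) t x‖ ≤ ε := by
  have hI := hf.integrable_sq_mul_sqrt hs
  have hloc := locallyIntegrable_angularFourier f
  have hlocneg : LocallyIntegrable fun ξ => angularFourier f (-ξ) := by
    have : MemLp (fun ξ => angularFourier f (-ξ)) 2 :=
      (memLp_angularFourier f).comp_measurePreserving (Measure.measurePreserving_neg volume)
    exact this.locallyIntegrable (by norm_num)
  have h1 := ae_uniform_small_tail (measurable_angularFourier f) hloc
    (hI.integrableOn.congr_fun (fun ξ hξ => by
      simp only; rw [abs_of_pos (zero_lt_one.trans hξ)]) measurableSet_Ioi)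
  have h2 := ae_uniform_small_tail ((measurable_angularFourier f).comp measurable_neg) hlocneg
    (hI.comp_neg.integrableOn.congr_fun (fun ξ hξ => by
      simp only [abs_neg]; rw [abs_of_pos (zero_lt_one.trans hξ)]; rfl) measurableSet_Ioi)
  -- Negative frequencies at x are positive frequencies of the reflected transform at -x, so its
  -- exceptional null set has to be reflected.
  have h3 := (Measure.measurePreserving_neg (volume : Measure ℝ)).quasiMeasurePreserving.ae h2
  filter_upwards [h1, h3] with x hx1 hx2 ε hε
  obtain ⟨N₁, hN₁⟩ := hx1 ε hε
  obtain ⟨N₂, hN₂⟩ := hx2 ε hε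
  refine ⟨max N₁ N₂, fun n hn t R hR => ?_⟩
  have b1 := hN₁ n (le_of_max_le_left hn) t R hR
  have b2 := hN₂ n (le_of_max_le_right hn) t R hR
  have e2 : ∫ ξ in (n + 1 : ℝ)..R, cis (-x * ξ + t * disp ξ) * (angularFourier f ∘ Neg.neg) ξ =
      ∫ ξ in (-R)..(-(n + 1 : ℝ)), cis (x * ξ + t * disp ξ) * angularFourier f ξ := by
    rw [← intervalIntegral.integral_comp_neg]
    refine intervalIntegral.integral_congr fun ξ _ => ?_
    simp
  simp only [Function.comp_def] at e2 b2
  rw [e2] at b2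
  have hi := fun a b => intervalIntegrable_cis_mul hloc
    (F := fun ξ => x * ξ + t * disp ξ) (by fun_prop) a b
  rw [boussinesqPartial_eq, boussinesqPartial_eq, ← mul_sub]
  have e3 : (∫ ξ in (-R)..R, cis (x * ξ + t * disp ξ) * angularFourier f ξ) -
      ∫ ξ in (-(n + 1 : ℝ))..(n + 1), cis (x * ξ + t * disp ξ) * angularFourier f ξ =
      (∫ ξ in (-R)..(-(n + 1 : ℝ)), cis (x * ξ + t * disp ξ) * angularFourier f ξ) +
      ∫ ξ in (n + 1 : ℝ)..R, cis (x * ξ + t * disp ξ) * angularFourier f ξ := by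
    rw [← intervalIntegral.integral_add_adjacent_intervals (hi (-R) (-(n + 1))) (hi (-(n + 1)) R),
      ← intervalIntegral.integral_add_adjacent_intervals (hi (-(n + 1)) (n + 1)) (hi (n + 1) R)]
    ring
  rw [e3, norm_mul]
  -- The prefactor absorbs the sum of the two tails, each at most ε.
  have hpi : ‖(2 * (Real.pi : ℂ))⁻¹‖ ≤ 1 / 2 := by
    rw [norm_inv, norm_mul, Complex.norm_real, Real.norm_eq_abs, abs_of_pos Real.pi_pos,
      Complex.norm_ofNat, inv_eq_one_div]
    exact one_div_le_one_div_of_le (by norm_num) (by nlinarith [Real.pi_gt_three])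
  calc _ ≤ 1 / 2 * (ε + ε) :=
        mul_le_mul hpi ((norm_add_le _ _).trans (add_le_add b2 b1)) (norm_nonneg _) (by norm_num)
    _ = ε := by ring

lemma eLpNorm_two_eq_sqrt {f : ℝ → ℂ} (hf : MemLp f 2) :
    eLpNorm f 2 volume = ENNReal.ofReal (√(∫ x, ‖f x‖ ^ 2)) := by
  rw [hf.eLpNorm_eq_integral_rpow_norm (by norm_num) (by norm_num)]
  simp [Real.sqrt_eq_rpow]

lemma tendsto_truncation_toLp (g : Lp ℂ 2 (volume : Measure ℝ)) {c : ℕ → ℝ}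
    (hc : Tendsto c atTop atTop) :
    Tendsto (fun n => ((Lp.memLp g).indicator
      (measurableSet_Ioc (a := -c n) (b := c n))).toLp _) atTop (𝓝 g) := by
  rw [Lp.tendsto_Lp_iff_tendsto_eLpNorm']
  set T : ℕ → ℝ → ℂ := fun n => (Ioc (-c n) (c n)).indicator g with hT
  have hTm : ∀ n, MemLp (T n) 2 := fun n => (Lp.memLp g).indicator measurableSet_Ioc
  have e : ∀ n, eLpNorm (⇑((hTm n).toLp (T n)) - ⇑g) 2 volume =
      ENNReal.ofReal (√(∫ x, ‖T n x - g x‖ ^ 2)) := by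
    intro n
    rw [← eLpNorm_two_eq_sqrt (f := fun x => T n x - g x) ((hTm n).sub (Lp.memLp g))]
    refine eLpNorm_congr_ae ?_
    filter_upwards [(hTm n).coeFn_toLp] with x hx
    simp [hx]
  change Tendsto (fun n => eLpNorm (⇑((hTm n).toLp (T n)) - ⇑g) 2 volume) atTop (𝓝 0)
  simp only [e]
  have hlim : Tendsto (fun n => ∫ x, ‖T n x - g x‖ ^ 2) atTop (𝓝 (∫ _ : ℝ, (0 : ℝ))) := by
    refine tendsto_integral_of_dominated_convergence (fun x => ‖g x‖ ^ 2) (fun n => ?_)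
      ((memLp_two_iff_integrable_sq_norm (Lp.aestronglyMeasurable _)).1 (Lp.memLp g))
      (fun n => Eventually.of_forall fun x => ?_) (Eventually.of_forall fun x => ?_)
    · exact (((hTm n).sub (Lp.memLp g)).aestronglyMeasurable.norm.pow 2)
    · rw [Real.norm_eq_abs, abs_of_nonneg (by positivity)]
      simp only [hT, indicator]
      split_ifs
      · simp
      · simp
    · refine tendsto_const_nhds.congr' ?_
      filter_upwards [hc.eventually_gt_atTop |x|] with n hn
      have : x ∈ Ioc (-c n) (c n) := ⟨by linarith [neg_abs_le x], (le_abs_self x).trans hn.le⟩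
      simp [hT, this]
  have := ENNReal.tendsto_ofReal hlim.sqrt
  simpa using this

lemma boussinesqPartial_eq_fourier (f : Lp ℂ 2 (volume : Measure ℝ)) (R t x : ℝ) :
    boussinesqPartial f R t x = ∫ w in (-(R / (2 * Real.pi)))..(R / (2 * Real.pi)),
      cis (2 * Real.pi * (x * w) + t * disp (2 * Real.pi * w)) *
        (𝓕 f : Lp ℂ 2 (volume : Measure ℝ)) w := by
  have h := intervalIntegral.integral_comp_div (a := -R) (b := R)
    (fun w => cis (2 * Real.pi * (x * w) + t * disp (2 * Real.pi * w)) *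
      (𝓕 f : Lp ℂ 2 (volume : Measure ℝ)) w) (c := 2 * Real.pi) (by positivity)
  rw [boussinesqPartial_eq, ← neg_div, inv_mul_eq_iff_eq_mul₀ (by simp [Real.pi_ne_zero])]
  rw [Complex.real_smul] at h
  push_cast at h
  rw [← h]
  refine intervalIntegral.integral_congr fun ξ _ => ?_
  have e : 2 * Real.pi * (ξ / (2 * Real.pi)) = ξ := by field_simp
  simp only [angularFourier, e]
  congr 3
  field_simp

/-- Along a sequence of truncations, the partial Fourier integrals converge to the function. -/
lemma exists_seq_ae_tendsto_boussinesqPartial_zero (f : Lp ℂ 2 (volume : Measure ℝ)) :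
    ∃ ns : ℕ → ℕ, StrictMono ns ∧
      ∀ᵐ x : ℝ, Tendsto (fun i => boussinesqPartial f (ns i) 0 x) atTop (𝓝 (f x)) := by
  set g : Lp ℂ 2 (volume : Measure ℝ) := 𝓕 f with hg
  set c : ℕ → ℝ := fun n => n / (2 * Real.pi) with hc
  have hct : Tendsto c atTop atTop :=
    tendsto_natCast_atTop_atTop.atTop_div_const (by positivity)
  have h1 := tendsto_truncation_toLp g hct
  have h2 := ((Lp.fourierTransformₗᵢ ℝ ℂ).symm.continuous.tendsto g).comp h1
  have h3 : (Lp.fourierTransformₗᵢ ℝ ℂ).symm g = f := (Lp.fourierTransformₗᵢ ℝ ℂ).symm_apply_apply f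
  rw [h3] at h2
  -- L² convergence gives pointwise convergence only along a subsequence. That is enough to identify
  -- the limit at t = 0, whose existence comes from the maximal estimate.
  obtain ⟨ns, hns, hlim⟩ := (tendstoInMeasure_of_tendsto_Lp h2).exists_seq_tendsto_ae
  refine ⟨ns, hns, ?_⟩
  have h4 : ∀ n, ∀ᵐ x : ℝ, ((Lp.fourierTransformₗᵢ ℝ ℂ).symm (((Lp.memLp g).indicator
      (measurableSet_Ioc (a := -c n) (b := c n))).toLp _) : ℝ → ℂ) x =
      boussinesqPartial f n 0 x := by
    intro n
    have hI : Integrable ((Ioc (-c n) (c n)).indicator (g : ℝ → ℂ)) := by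
      rw [integrable_indicator_iff measurableSet_Ioc]
      exact ((Lp_locallyIntegrable g).integrableOn_isCompact isCompact_Icc).mono_set
        Ioc_subset_Icc_self
    filter_upwards [fourierInv_toLp_ae_eq hI ((Lp.memLp g).indicator measurableSet_Ioc)] with x hx
    refine hx.trans ?_
    have hcn : -c n ≤ c n := by
      have : 0 ≤ c n := by simp only [hc]; positivity
      linarith
    rw [boussinesqPartial_eq_fourier, intervalIntegral.integral_of_le hcn,
      ← integral_indicator measurableSet_Ioc]
    refine integral_congr_ae (Eventually.of_forall fun w => ?_)
    simp only [indicator]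
    split_ifs
    · rw [hg, zero_mul, add_zero]
    · simp
  filter_upwards [hlim, ae_all_iff.2 h4] with x hx hx4
  refine hx.congr fun i => ?_
  exact hx4 (ns i)

lemma continuous_boussinesqPartial (f : Lp ℂ 2 (volume : Measure ℝ)) (R x : ℝ) :
    Continuous fun t => boussinesqPartial f R t x := by
  simp only [boussinesqPartial_eq]
  refine continuous_const.mul ?_
  exact (continuous_windowIntegral (locallyIntegrable_angularFourier f) (-R)).comp
    (f := fun t : ℝ => ((x, t), R)) (by fun_prop)

/-- Almost everywhere convergence for data in `H^s`, `s ≥ 1/4`. -/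
theorem boussinesqConvergesAE_of_memHs {s : ℝ} (hs : 1 / 4 ≤ s) {f : Lp ℂ 2 (volume : Measure ℝ)}
    (hf : MemHs s f) : BoussinesqConvergesAE f := by
  obtain ⟨ns, hns, hae⟩ := exists_seq_ae_tendsto_boussinesqPartial_zero f
  filter_upwards [ae_uniform_boussinesqPartial hs hf, hae] with x hx hlim
  -- Uniformity in all t makes the limit continuous in time, so convergence as t → 0 reduces to the
  -- value at t = 0.
  have hcauchy : UniformCauchySeqOn (fun R t => boussinesqPartial f R t x) atTop univ := by
    rw [Metric.uniformCauchySeqOn_iff]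
    intro ε hε
    obtain ⟨N, hN⟩ := hx (ε / 3) (by positivity)
    refine ⟨N + 1, fun m hm n hn t _ => ?_⟩
    have h1 := hN N le_rfl t m hm
    have h2 := hN N le_rfl t n hn
    rw [← dist_eq_norm] at h1 h2
    calc _ ≤ _ := dist_triangle_right _ _ (boussinesqPartial f (N + 1) t x)
      _ < ε := by linarith
  have hex : ∀ t, BoussinesqExists f t x := fun t =>
    cauchy_map_iff_exists_tendsto.1 (hcauchy.cauchy_map (mem_univ t))
  have hten : ∀ t, Tendsto (fun R => boussinesqPartial f R t x) atTop (𝓝 (boussinesq f t x)) :=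
    fun t => tendsto_nhds_limUnder (hex t)
  refine ⟨hex, ?_⟩
  have hunif := hcauchy.tendstoUniformlyOn_of_tendsto fun t _ => hten t
  have hcont : Continuous fun t => boussinesq f t x := by
    rw [← continuousOn_univ]
    exact hunif.continuousOn
      (Frequently.of_forall fun R => (continuous_boussinesqPartial f R x).continuousOn)
  have h0 : boussinesq f 0 x = f x :=
    tendsto_nhds_unique ((hten 0).comp (tendsto_natCast_atTop_atTop.comp hns.tendsto_atTop)) hlim
  rw [← h0]
  exact (hcont.tendsto 0).mono_left nhdsWithin_le_nhds

/-! ### Taylor expansion of the phase and truncated kernels -/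

lemma norm_cis_sub_cis_le (a b : ℝ) : ‖cis a - cis b‖ ≤ |a - b| := by
  have e : cis a - cis b = cis b * (Complex.exp (Complex.I * ((a - b : ℝ) : ℂ)) - 1) := by
    rw [mul_sub, mul_one]
    congr 1
    rw [← cis, ← cis_add]; congr 1; ring
  rw [e, norm_mul, norm_cis, one_mul]
  exact Real.norm_exp_I_mul_ofReal_sub_one_le

lemma abs_dispOdd_taylor_le {ξ ξ₀ : ℝ} (h : 0 ≤ ξ) (h₀ : 0 ≤ ξ₀) :
    |dispOdd ξ - dispOdd ξ₀ - dispOdd' ξ₀ * (ξ - ξ₀)| ≤ 3 * (ξ - ξ₀) ^ 2 := by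
  have hpos : ∀ y ∈ uIcc ξ₀ ξ, 0 ≤ y := fun y hy => (le_min h₀ h).trans hy.1
  have hle : ∀ y ∈ uIcc ξ₀ ξ, |y - ξ₀| ≤ |ξ - ξ₀| := fun y hy => abs_sub_left_of_mem_uIcc hy
  have hd2 : ∀ y ∈ uIcc ξ₀ ξ, ‖dispOdd'' y‖ ≤ 3 := fun y hy => by
    have hy0 := hpos y hy
    rw [Real.norm_eq_abs, abs_of_nonneg (by unfold dispOdd''; positivity)]
    exact dispOdd''_le hy0
  have h1 : ∀ y ∈ uIcc ξ₀ ξ, ‖dispOdd' y - dispOdd' ξ₀‖ ≤ 3 * |ξ - ξ₀| := fun y hy => by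
    refine ((convex_uIcc ξ₀ ξ).norm_image_sub_le_of_norm_hasDerivWithin_le
      (fun z _ => (hasDerivAt_dispOdd' z).hasDerivWithinAt) hd2 left_mem_uIcc hy).trans ?_
    exact mul_le_mul_of_nonneg_left (hle y hy) (by norm_num)
  have hder : ∀ y, HasDerivAt (fun y => dispOdd y - dispOdd' ξ₀ * (y - ξ₀))
      (dispOdd' y - dispOdd' ξ₀) y := fun y =>
    HasDerivAt.congr_deriv ((hasDerivAt_dispOdd y).sub
      (((hasDerivAt_id y).sub_const ξ₀).const_mul (dispOdd' ξ₀))) (by simp)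
  have h2 := (convex_uIcc ξ₀ ξ).norm_image_sub_le_of_norm_hasDerivWithin_le
      (fun z _ => (hder z).hasDerivWithinAt) h1 left_mem_uIcc right_mem_uIcc
  rw [Real.norm_eq_abs, Real.norm_eq_abs] at h2
  calc _ = |dispOdd ξ - dispOdd' ξ₀ * (ξ - ξ₀) - (dispOdd ξ₀ - dispOdd' ξ₀ * (ξ₀ - ξ₀))| := by
        congr 1; ring
    _ ≤ _ := h2
    _ = 3 * (ξ - ξ₀) ^ 2 := by rw [mul_assoc, ← sq, sq_abs]

/-- Across the corner at 0 no smoothness is needed: if ξ < 0, the distance ξ₀ - ξ is at least 1 and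
exceeds both |ξ| and ξ₀, so every term is separately bounded by a multiple of its square. -/
lemma abs_disp_taylor_le (ξ : ℝ) {ξ₀ : ℝ} (h₀ : 1 ≤ ξ₀) :
    |disp ξ - disp ξ₀ - dispOdd' ξ₀ * (ξ - ξ₀)| ≤ 7 * (ξ - ξ₀) ^ 2 := by
  rcases le_or_gt 0 ξ with h | h
  · rw [disp_of_nonneg h, disp_of_nonneg (by linarith)]
    refine (abs_dispOdd_taylor_le h (by linarith)).trans ?_
    nlinarith [sq_nonneg (ξ - ξ₀)]
  · have b1 := disp_le ξ
    have b2 := disp_le ξ₀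
    have b3 := dispOdd'_le h₀
    have b4 := le_dispOdd' (by linarith : 0 ≤ ξ₀)
    have b5 := disp_nonneg ξ
    have b6 := disp_nonneg ξ₀
    rw [abs_of_neg h] at b1
    rw [abs_of_pos (by linarith)] at b2
    have b7 : dispOdd' ξ₀ * (ξ₀ - ξ) ≤ 3 * ξ₀ * (ξ₀ - ξ) :=
      mul_le_mul_of_nonneg_right b3 (by linarith)
    have b8 : 0 ≤ dispOdd' ξ₀ * (ξ₀ - ξ) := mul_nonneg (by linarith) (by linarith)
    rw [abs_le]
    constructor <;> nlinarith

/-- The kernel of the truncated evolution is bounded uniformly in the truncation, for `t ≠ 0`. -/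
lemma norm_integral_symm_dispersive_le {R t z : ℝ} (hR : 0 ≤ R) (ht : t ≠ 0) :
    ‖∫ ξ in (-R)..R, cis (z * ξ + t * disp ξ)‖ ≤ 2 + 24 / √|t| := by
  have hi : ∀ a b, IntervalIntegrable (fun ξ => cis (z * ξ + t * disp ξ)) volume a b :=
    fun a b => Continuous.intervalIntegrable (by fun_prop) a b
  have htriv : ∀ r, 0 ≤ r → r ≤ 1 → ‖∫ ξ in (-r)..r, cis (z * ξ + t * disp ξ)‖ ≤ 2 := by
    intro r hr0 hr
    refine (intervalIntegral.norm_integral_le_of_norm_le_const (C := 1) fun ξ _ => by simp).trans ?_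
    rw [abs_of_nonneg (by linarith)]; linarith
  rcases le_total R 1 with h | h
  · refine (htriv R hR h).trans ?_
    have : 0 ≤ 24 / √|t| := by positivity
    linarith
  · rw [← intervalIntegral.integral_add_adjacent_intervals (hi (-R) (-1)) (hi (-1) R),
      ← intervalIntegral.integral_add_adjacent_intervals (hi (-1) 1) (hi 1 R)]
    have e : ∫ ξ in (-R)..(-1), cis (z * ξ + t * disp ξ) =
        ∫ ξ in (1 : ℝ)..R, cis (-z * ξ + t * disp ξ) := by
      rw [← intervalIntegral.integral_comp_neg]
      refine intervalIntegral.integral_congr fun ξ _ => ?_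
      simp
    rw [e]
    have b1 := norm_integral_dispersive_le (x := -z) ht le_rfl h
    have b2 := htriv 1 zero_le_one le_rfl
    have b3 := norm_integral_dispersive_le (x := z) ht le_rfl h
    have e2 : 2 + 24 / √|t| = 12 / √|t| + (2 + 12 / √|t|) := by ring
    rw [e2]
    exact (norm_add_le _ _).trans (add_le_add b1 ((norm_add_le _ _).trans (add_le_add b2 b3)))

/-- At t = 0 dispersion gives nothing; the bound comes from the distance to the support of the data.
-/
lemma norm_integral_symm_cis_le {R z : ℝ} (hz : z ≠ 0) :
    ‖∫ ξ in (-R)..R, cis (z * ξ)‖ ≤ 2 / |z| := by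
  have hzc : Complex.I * (z : ℂ) ≠ 0 := by simp [hz]
  have h := integral_exp_mul_complex (a := -R) (b := R) hzc
  have e : ∀ ξ : ℝ, cis (z * ξ) = Complex.exp (Complex.I * (z : ℂ) * ξ) := fun ξ => by
    simp [cis, mul_assoc]
  simp only [e, h]
  rw [norm_div, norm_mul, Complex.norm_I, one_mul, Complex.norm_real, Real.norm_eq_abs]
  gcongr
  rw [← e, ← e]
  refine (norm_sub_le _ _).trans ?_
  simp; norm_num

/-! ### The evolution of Schwartz functions -/

lemma fourier_toLp_ae (F : 𝓢(ℝ, ℂ)) :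
    ((𝓕 (F.toLp 2) : Lp ℂ 2 (volume : Measure ℝ)) : ℝ → ℂ) =ᵐ[volume] (𝓕 F : 𝓢(ℝ, ℂ)) := by
  rw [SchwartzMap.toLp_fourier_eq]
  exact SchwartzMap.coeFn_toLp _ _ _

/-- The Boussinesq evolution of a Schwartz function, as an absolutely convergent integral. -/
noncomputable def evolution (F : 𝓢(ℝ, ℂ)) (t x : ℝ) : ℂ :=
  ∫ w, cis (2 * Real.pi * (x * w) + t * disp (2 * Real.pi * w)) * (𝓕 F : 𝓢(ℝ, ℂ)) w

lemma boussinesqPartial_toLp (F : 𝓢(ℝ, ℂ)) (R t x : ℝ) :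
    boussinesqPartial (F.toLp 2) R t x =
      ∫ w in (-(R / (2 * Real.pi)))..(R / (2 * Real.pi)),
        cis (2 * Real.pi * (x * w) + t * disp (2 * Real.pi * w)) * (𝓕 F : 𝓢(ℝ, ℂ)) w := by
  rw [boussinesqPartial_eq_fourier]
  refine intervalIntegral.integral_congr_ae ?_
  filter_upwards [fourier_toLp_ae F] with w hw _
  rw [hw]

lemma integrable_cis_mul_schwartz (F : 𝓢(ℝ, ℂ)) {θ : ℝ → ℝ} (hθ : Continuous θ) :
    Integrable fun w => cis (θ w) * F w := by
  refine F.integrable.mono ?_ (Eventually.of_forall fun w => by simp)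
  exact Continuous.aestronglyMeasurable (by fun_prop)

lemma tendsto_boussinesqPartial_toLp (F : 𝓢(ℝ, ℂ)) (t x : ℝ) :
    Tendsto (fun R => boussinesqPartial (F.toLp 2) R t x) atTop (𝓝 (evolution F t x)) := by
  simp only [boussinesqPartial_toLp]
  have hR : Tendsto (fun R : ℝ => R / (2 * Real.pi)) atTop atTop :=
    tendsto_id.atTop_div_const (by positivity)
  exact intervalIntegral_tendsto_integral (integrable_cis_mul_schwartz _ (by fun_prop))
    (tendsto_neg_atTop_atBot.comp hR) hR

/-- A bound of the truncated kernel on the support gives a bound of the partial integrals by the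
`L¹` norm. -/
lemma norm_boussinesqPartial_toLp_le (F : 𝓢(ℝ, ℂ)) {R t x C : ℝ} (hR : 0 ≤ R)
    (hC : ∀ y, F y ≠ 0 → ‖∫ ξ in (-R)..R, cis ((x - y) * ξ + t * disp ξ)‖ ≤ C) :
    ‖boussinesqPartial (F.toLp 2) R t x‖ ≤ C * ∫ y, ‖F y‖ := by
  have hFI : Integrable F := F.integrable
  have hle : -R ≤ R := by linarith
  have hprod : Integrable (fun p : ℝ × ℝ => cis ((x - p.2) * p.1 + t * disp p.1) * F p.2)
      ((volume.restrict (Ioc (-R) R)).prod volume) := by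
    refine (hFI.comp_snd (volume.restrict (Ioc (-R) R))).mono ?_
      (Eventually.of_forall fun p => by simp)
    exact Continuous.aestronglyMeasurable (by fun_prop)
  have hae : ∀ᵐ ξ : ℝ, angularFourier (F.toLp 2) ξ = (𝓕 F : 𝓢(ℝ, ℂ)) (ξ / (2 * Real.pi)) := by
    have hq : Measure.QuasiMeasurePreserving (fun ξ : ℝ => ξ / (2 * Real.pi)) volume volume := by
      refine ⟨by fun_prop, ?_⟩
      have : (fun ξ : ℝ => ξ / (2 * Real.pi)) = fun ξ => ξ * (2 * Real.pi)⁻¹ := by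
        ext ξ; rw [div_eq_mul_inv]
      rw [this, Real.map_volume_mul_right (by positivity)]
      exact Measure.smul_absolutelyContinuous
    exact hq.ae (fourier_toLp_ae F)
  -- On a bounded frequency window Fubini applies and writes the partial integral as a convolution
  -- of F with the truncated kernel.
  have key : ∫ ξ in (-R)..R, cis (x * ξ + t * disp ξ) * angularFourier (F.toLp 2) ξ =
      ∫ y, (∫ ξ in (-R)..R, cis ((x - y) * ξ + t * disp ξ)) * F y := by
    calc _ = ∫ ξ in Ioc (-R) R, ∫ y, cis ((x - y) * ξ + t * disp ξ) * F y := by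
          rw [intervalIntegral.integral_of_le hle]
          refine integral_congr_ae (ae_restrict_of_ae ?_)
          filter_upwards [hae] with ξ hξ
          rw [hξ, schwartz_fourier_apply, ← integral_const_mul]
          refine integral_congr_ae (Eventually.of_forall fun y => ?_)
          simp only
          rw [← mul_assoc, ← cis_add]
          congr 2
          field_simp
          ring
      _ = ∫ y, ∫ ξ in Ioc (-R) R, cis ((x - y) * ξ + t * disp ξ) * F y :=
          integral_integral_swap hprod
      _ = _ := by
          refine integral_congr_ae (Eventually.of_forall fun y => ?_)
          simp only [integral_mul_const, intervalIntegral.integral_of_le hle]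
  rw [boussinesqPartial_eq, key, norm_mul]
  have hpi : ‖(2 * (Real.pi : ℂ))⁻¹‖ ≤ 1 := by
    rw [norm_inv, norm_mul, Complex.norm_real, Real.norm_eq_abs, abs_of_pos Real.pi_pos,
      Complex.norm_ofNat]
    exact inv_le_one_of_one_le₀ (by nlinarith [Real.pi_gt_three])
  refine (mul_le_of_le_one_left (norm_nonneg _) hpi).trans ?_
  rw [← integral_const_mul]
  refine norm_integral_le_of_norm_le (hFI.norm.const_mul C) (Eventually.of_forall fun y => ?_)
  by_cases hy : F y = 0
  · simp [hy]
  · rw [norm_mul]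
    exact mul_le_mul_of_nonneg_right (hC y hy) (norm_nonneg _)

lemma evolution_zero (F : 𝓢(ℝ, ℂ)) (x : ℝ) : evolution F 0 x = F x := by
  have h : (𝓕⁻ (𝓕 F) : 𝓢(ℝ, ℂ)) x = F x := by rw [FourierTransform.fourierInv_fourier_eq]
  rw [← h, schwartz_fourierInv_apply]
  refine integral_congr_ae (Eventually.of_forall fun w => ?_)
  simp only [zero_mul, add_zero, mul_comm x w]

/-! ### Wave packets -/

/-- `F` is the wave packet with profile `b`, width `v` and frequency `v⁻²`. -/
def IsPacket (b : 𝓢(ℝ, ℂ)) (v : ℝ) (F : 𝓢(ℝ, ℂ)) : Prop :=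
  ∀ x, F x = cis (2 * Real.pi * (x / v ^ 2)) * b (x / v)

lemma exists_isPacket {b : 𝓢(ℝ, ℂ)} (hb : HasCompactSupport b) {v : ℝ} (hv : 0 < v) :
    ∃ F, IsPacket b v F := by
  have hc : HasCompactSupport fun x : ℝ => cis (2 * Real.pi * (x / v ^ 2)) * b (x / v) := by
    have h1 : HasCompactSupport fun x : ℝ => b (x / v) := by
      have := hb.comp_homeomorph (Homeomorph.mulRight₀ v⁻¹ (inv_ne_zero hv.ne'))
      simpa [Function.comp_def, div_eq_mul_inv] using this
    exact h1.mul_left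
  have hs : ContDiff ℝ (⊤ : ℕ∞) fun x : ℝ => cis (2 * Real.pi * (x / v ^ 2)) * b (x / v) := by
    have h1 : ContDiff ℝ (⊤ : ℕ∞) fun x : ℝ => b (x / v) :=
      (b.smooth ⊤).comp (contDiff_id.div_const v)
    have h2 : ContDiff ℝ (⊤ : ℕ∞) fun x : ℝ => cis (2 * Real.pi * (x / v ^ 2)) := by
      unfold cis
      refine (contDiff_const.mul (Complex.ofRealCLM.contDiff.comp ?_)).cexp
      exact contDiff_const.mul (contDiff_id.div_const _)
    exact h2.mul h1
  exact ⟨hc.toSchwartzMap hs, fun x => rfl⟩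

namespace IsPacket

variable {b F : 𝓢(ℝ, ℂ)} {v : ℝ}

lemma eq_zero_of_lt_abs (hF : IsPacket b v F) (hv : 0 < v) {r : ℝ}
    (hb : ∀ y, r < |y| → b y = 0) {x : ℝ} (hx : r * v < |x|) : F x = 0 := by
  rw [hF, hb, mul_zero]
  rw [abs_div, abs_of_pos hv, lt_div_iff₀ hv]
  exact hx

lemma integral_norm (hF : IsPacket b v F) (hv : 0 < v) : ∫ x, ‖F x‖ = v * ∫ x, ‖b x‖ := by
  simp only [hF _, norm_mul, norm_cis, one_mul]
  rw [Measure.integral_comp_div (fun x => ‖b x‖), abs_of_pos hv, smul_eq_mul]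

/-- Modulation centers the transform at v⁻², and dilation gives it width 1/v, much smaller than v⁻²
when v is small. -/
lemma fourier_apply (hF : IsPacket b v F) (hv : 0 < v) (w : ℝ) :
    (𝓕 F : 𝓢(ℝ, ℂ)) w = (v : ℂ) * (𝓕 b : 𝓢(ℝ, ℂ)) (v * (w - (v ^ 2)⁻¹)) := by
  rw [schwartz_fourier_apply, schwartz_fourier_apply]
  have h := Measure.integral_comp_div
    (fun y => cis (-(2 * Real.pi * (y * (v * (w - (v ^ 2)⁻¹))))) * b y) v
  rw [abs_of_pos hv, Complex.real_smul] at h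
  rw [← h]
  refine integral_congr_ae (Eventually.of_forall fun y => ?_)
  simp only [hF y]
  rw [← mul_assoc, ← cis_add]
  congr 2
  field_simp
  ring

end IsPacket

/-- The affine substitution in frequency that centers a wave packet. -/
lemma integral_packet_subst {E : Type*} [NormedAddCommGroup E] [NormedSpace ℝ E] (Φ : ℝ → E)
    {v : ℝ} (hv : 0 < v) : ∫ w, Φ (v * (w - (v ^ 2)⁻¹)) = v⁻¹ • ∫ ω, Φ ω := by
  rw [integral_sub_right_eq_self (fun w => Φ (v * w)), Measure.integral_comp_mul_left,
    abs_of_pos (inv_pos.2 hv)]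

/-- In the rescaled variable ω one has v²w = 1 + vω, and for v ≤ 1 both (1 + vω)² ≤ 2 + 2ω² and v⁴ ≤
1. -/
lemma frequency_sq_le {v : ℝ} (hv : 0 < v) (hv1 : v ≤ 1) (w : ℝ) :
    1 + w ^ 2 ≤ 3 * (1 + (v * (w - (v ^ 2)⁻¹)) ^ 2) / v ^ 4 := by
  set ω := v * (w - (v ^ 2)⁻¹) with hω
  have hw : v ^ 2 * w = v * ω + 1 := by rw [hω]; field_simp; ring
  rw [le_div_iff₀ (by positivity)]
  have h1 : w ^ 2 * v ^ 4 = (v * ω + 1) ^ 2 := by rw [← hw]; ring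
  have h2 : v ^ 4 ≤ 1 := pow_le_one₀ hv.le hv1
  have h3 : (v * ω) ^ 2 ≤ ω ^ 2 := by
    rw [mul_pow]; exact mul_le_of_le_one_left (sq_nonneg _) (pow_le_one₀ hv.le hv1)
  nlinarith [sq_nonneg (v * ω - 1)]

lemma integrable_one_add_sq_mul_norm (b : 𝓢(ℝ, ℂ)) :
    Integrable fun ω => (1 + ω ^ 2) * ‖b ω‖ := by
  have h := (b.integrable_pow_mul volume 0).add (b.integrable_pow_mul volume 2)
  refine h.congr (Eventually.of_forall fun ω => ?_)
  simp; ring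

lemma integrable_one_add_sq_mul_norm_sq (b : 𝓢(ℝ, ℂ)) :
    Integrable fun ω => (1 + ω ^ 2) * ‖b ω‖ ^ 2 := by
  refine ((integrable_one_add_sq_mul_norm b).mul_const (SchwartzMap.seminorm ℝ 0 0 b)).mono'
    (Continuous.aestronglyMeasurable (by fun_prop)) (Eventually.of_forall fun ω => ?_)
  rw [Real.norm_eq_abs, abs_of_nonneg (by positivity), mul_assoc, sq ‖b ω‖]
  gcongr
  exact b.norm_le_seminorm ℝ ω

/-- The time factor differs from 1 by at most |t|ω(ξ), which is integrated against the transform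
after Fourier inversion at t = 0. -/
lemma norm_evolution_sub_le (F : 𝓢(ℝ, ℂ)) (t x : ℝ)
    (hI : Integrable fun w => disp (2 * Real.pi * w) * ‖(𝓕 F : 𝓢(ℝ, ℂ)) w‖) :
    ‖evolution F t x - F x‖ ≤ |t| * ∫ w, disp (2 * Real.pi * w) * ‖(𝓕 F : 𝓢(ℝ, ℂ)) w‖ := by
  rw [← evolution_zero F x, evolution, evolution, ← integral_sub
    (integrable_cis_mul_schwartz _ (by fun_prop)) (integrable_cis_mul_schwartz _ (by fun_prop)),
    ← integral_const_mul]
  refine norm_integral_le_of_norm_le (hI.const_mul _) (Eventually.of_forall fun w => ?_)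
  rw [← sub_mul, norm_mul, ← mul_assoc |t|]
  refine mul_le_mul_of_nonneg_right ((norm_cis_sub_cis_le _ _).trans (le_of_eq ?_))
    (norm_nonneg ((𝓕 F : 𝓢(ℝ, ℂ)) w))
  rw [zero_mul, add_zero, add_sub_cancel_left, abs_mul, abs_of_nonneg (disp_nonneg _)]

lemma disp_two_pi_mul_le (w : ℝ) : disp (2 * Real.pi * w) ≤ 98 * (1 + w ^ 2) := by
  have h1 := disp_le (2 * Real.pi * w)
  have h2 : |2 * Real.pi * w| = 2 * Real.pi * |w| := by
    rw [abs_mul, abs_of_pos (by positivity)]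
  have h3 : Real.pi ≤ 4 := Real.pi_le_four
  have h4 : |w| ≤ (1 + w ^ 2) / 2 := by nlinarith [sq_nonneg (|w| - 1), sq_abs w]
  have h5 : 2 * Real.pi * |w| ≤ 8 * |w| := by nlinarith [abs_nonneg w]
  have h6 : Real.pi ^ 2 ≤ 16 := by nlinarith [Real.pi_pos]
  have h7 : (2 * Real.pi * w) ^ 2 ≤ 64 * w ^ 2 := by
    have : (2 * Real.pi * w) ^ 2 = 4 * (Real.pi ^ 2 * w ^ 2) := by ring
    rw [this]
    have := mul_le_mul_of_nonneg_right h6 (sq_nonneg w)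
    linarith
  nlinarith [sq_nonneg w]

namespace IsPacket

variable {b F : 𝓢(ℝ, ℂ)} {v : ℝ}

/-- Small times: a wave packet stays small where it vanishes initially. -/
lemma norm_evolution_le_of_eq_zero (hF : IsPacket b v F) (hv : 0 < v) (hv1 : v ≤ 1) {t x : ℝ}
    (hx : F x = 0) :
    ‖evolution F t x‖ ≤ |t| * (294 * (∫ ω, (1 + ω ^ 2) * ‖(𝓕 b : 𝓢(ℝ, ℂ)) ω‖) / v ^ 4) := by
  have hI0 := integrable_one_add_sq_mul_norm (𝓕 F : 𝓢(ℝ, ℂ))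
  have hI : Integrable fun w => disp (2 * Real.pi * w) * ‖(𝓕 F : 𝓢(ℝ, ℂ)) w‖ := by
    refine (hI0.const_mul 98).mono' (Continuous.aestronglyMeasurable (by fun_prop))
      (Eventually.of_forall fun w => ?_)
    rw [Real.norm_eq_abs, abs_of_nonneg (mul_nonneg (disp_nonneg _) (norm_nonneg _)), ← mul_assoc]
    exact mul_le_mul_of_nonneg_right (disp_two_pi_mul_le w) (norm_nonneg _)
  have h := norm_evolution_sub_le F t x hI
  rw [hx, sub_zero] at h
  refine h.trans (mul_le_mul_of_nonneg_left ?_ (abs_nonneg t))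
  have hb := integrable_one_add_sq_mul_norm (𝓕 b : 𝓢(ℝ, ℂ))
  have hsub := integral_packet_subst (fun ω => (1 + ω ^ 2) * ‖(𝓕 b : 𝓢(ℝ, ℂ)) ω‖) hv
  have hbI : Integrable fun w => (1 + (v * (w - (v ^ 2)⁻¹)) ^ 2) *
      ‖(𝓕 b : 𝓢(ℝ, ℂ)) (v * (w - (v ^ 2)⁻¹))‖ :=
    (hb.comp_mul_left' hv.ne').comp_sub_right ((v ^ 2)⁻¹)
  calc ∫ w, disp (2 * Real.pi * w) * ‖(𝓕 F : 𝓢(ℝ, ℂ)) w‖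
      ≤ ∫ w, (294 * v / v ^ 4) * ((1 + (v * (w - (v ^ 2)⁻¹)) ^ 2) *
          ‖(𝓕 b : 𝓢(ℝ, ℂ)) (v * (w - (v ^ 2)⁻¹))‖) := by
        refine integral_mono hI (hbI.const_mul _) fun w => ?_
        simp only
        rw [hF.fourier_apply hv, norm_mul, Complex.norm_real, Real.norm_eq_abs, abs_of_pos hv]
        have h1 := (disp_two_pi_mul_le w).trans
          (mul_le_mul_of_nonneg_left (frequency_sq_le hv hv1 w) (by norm_num))
        have h2 := mul_le_mul_of_nonneg_right h1
          (by positivity : 0 ≤ v * ‖(𝓕 b : 𝓢(ℝ, ℂ)) (v * (w - (v ^ 2)⁻¹))‖)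
        refine h2.trans (le_of_eq ?_)
        ring
    _ = 294 * (∫ ω, (1 + ω ^ 2) * ‖(𝓕 b : 𝓢(ℝ, ℂ)) ω‖) / v ^ 4 := by
        rw [integral_const_mul, hsub, smul_eq_mul]
        field_simp

/-- The wave packet is of size one at the time at which it arrives. -/
lemma one_sub_le_norm_evolution (hF : IsPacket b v F) (hb0 : b 0 = 1) (hv : 0 < v) (hv1 : v ≤ 1)
    {x : ℝ} (hx : x ≤ 0) :
    1 - 14 * Real.pi * |x| * (∫ ω, (1 + ω ^ 2) * ‖(𝓕 b : 𝓢(ℝ, ℂ)) ω‖) ≤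
      ‖evolution F (|x| / dispOdd' (2 * Real.pi / v ^ 2)) x‖ := by
  set ξ₀ := 2 * Real.pi / v ^ 2 with hξ₀
  set t := |x| / dispOdd' ξ₀ with ht
  have hv2 : v ^ 2 ≤ 1 := pow_le_one₀ hv.le hv1
  have hξ1 : 1 ≤ ξ₀ := by
    rw [hξ₀, le_div_iff₀ (by positivity)]; nlinarith [Real.pi_gt_three]
  have hd : ξ₀ ≤ dispOdd' ξ₀ := le_dispOdd' (by linarith)
  have hdpos : 0 < dispOdd' ξ₀ := by linarith
  have ht0 : 0 ≤ t := by positivity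
  have htd : t * dispOdd' ξ₀ = -x := by
    rw [ht, div_mul_cancel₀ _ hdpos.ne', abs_of_nonpos hx]
  have htle : t ≤ |x| * v ^ 2 / (2 * Real.pi) := by
    calc t ≤ |x| / ξ₀ := div_le_div_of_nonneg_left (abs_nonneg x) (by linarith) hd
      _ = _ := by rw [hξ₀]; field_simp
  set θ : ℝ → ℝ := fun ω => 2 * Real.pi * (x * (ω / v + (v ^ 2)⁻¹)) +
    t * disp (2 * Real.pi * (ω / v + (v ^ 2)⁻¹)) with hθ
  set θ₀ : ℝ := 2 * Real.pi * (x * (v ^ 2)⁻¹) + t * disp ξ₀ with hθ₀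
  have hev : evolution F t x = ∫ ω, cis (θ ω) * (𝓕 b : 𝓢(ℝ, ℂ)) ω := by
    have hsub := integral_packet_subst (fun ω => cis (θ ω) * (𝓕 b : 𝓢(ℝ, ℂ)) ω) hv
    rw [Complex.real_smul, Complex.ofReal_inv, eq_inv_mul_iff_mul_eq₀ (by exact_mod_cast hv.ne'),
      ← integral_const_mul] at hsub
    rw [← hsub, evolution]
    refine integral_congr_ae (Eventually.of_forall fun w => ?_)
    have e : v * (w - (v ^ 2)⁻¹) / v + (v ^ 2)⁻¹ = w := by field_simp; ring
    simp only [hθ, e, hF.fourier_apply hv w]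
    ring
  have hb1 : ∫ ω, (𝓕 b : 𝓢(ℝ, ℂ)) ω = 1 := by
    have := evolution_zero b 0
    simpa [evolution, hb0] using this
  have hmain : ∫ ω, cis θ₀ * (𝓕 b : 𝓢(ℝ, ℂ)) ω = cis θ₀ := by
    rw [integral_const_mul, hb1, mul_one]
  -- At the arrival time the linear Taylor term cancels the translation. The quadratic remainder is
  -- at most |x|v²/(2π) · 7(2πω/v)² = 14π|x|ω²: the powers of v cancel, which is why the frequency
  -- is v⁻².
  have hphase : ∀ ω, |θ ω - θ₀| ≤ 14 * Real.pi * |x| * (1 + ω ^ 2) := by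
    intro ω
    have h1 := abs_disp_taylor_le (2 * Real.pi * (ω / v + (v ^ 2)⁻¹)) hξ1
    have e1 : 2 * Real.pi * (ω / v + (v ^ 2)⁻¹) - ξ₀ = 2 * Real.pi * ω / v := by
      rw [hξ₀]; field_simp; ring
    rw [e1] at h1
    have e2 : θ ω - θ₀ = t * (disp (2 * Real.pi * (ω / v + (v ^ 2)⁻¹)) - disp ξ₀ -
        dispOdd' ξ₀ * (2 * Real.pi * ω / v)) := by
      have : t * (dispOdd' ξ₀ * (2 * Real.pi * ω / v)) = -x * (2 * Real.pi * ω / v) := by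
        rw [← mul_assoc, htd]
      rw [mul_sub, this]
      simp only [hθ, hθ₀]
      ring
    rw [e2, abs_mul, abs_of_nonneg ht0]
    calc t * _ ≤ (|x| * v ^ 2 / (2 * Real.pi)) * (7 * (2 * Real.pi * ω / v) ^ 2) := by gcongr
      _ = 14 * Real.pi * |x| * ω ^ 2 := by field_simp; ring
      _ ≤ _ := by gcongr; linarith
  have hdiff : ‖evolution F t x - cis θ₀‖ ≤
      14 * Real.pi * |x| * ∫ ω, (1 + ω ^ 2) * ‖(𝓕 b : 𝓢(ℝ, ℂ)) ω‖ := by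
    rw [hev]
    nth_rw 1 [← hmain]
    rw [← integral_sub (integrable_cis_mul_schwartz _ (by fun_prop))
      (integrable_cis_mul_schwartz _ continuous_const), ← integral_const_mul]
    refine norm_integral_le_of_norm_le
      ((integrable_one_add_sq_mul_norm (𝓕 b : 𝓢(ℝ, ℂ))).const_mul _)
      (Eventually.of_forall fun ω => ?_)
    rw [← sub_mul, norm_mul, ← mul_assoc]
    exact mul_le_mul_of_nonneg_right ((norm_cis_sub_cis_le _ _).trans (hphase ω)) (norm_nonneg _)
  have h2 := norm_sub_norm_le (cis θ₀) (evolution F t x)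
  rw [norm_cis, norm_sub_rev] at h2
  linarith

/-- The squared L² norm scales like v and the weight at frequency v⁻² costs v^{-4s}. The exponent 1
- 4s is positive exactly when s < 1/4. -/
lemma integral_weighted_sq_le (hF : IsPacket b v F) (hv : 0 < v) (hv1 : v ≤ 1) {s : ℝ}
    (hs : 0 ≤ s) (hs1 : s ≤ 1) :
    ∫ w, ‖(((1 + w ^ 2) ^ (s / 2) : ℝ) : ℂ) * (𝓕 F : 𝓢(ℝ, ℂ)) w‖ ^ 2 ≤
      3 * (∫ ω, (1 + ω ^ 2) * ‖(𝓕 b : 𝓢(ℝ, ℂ)) ω‖ ^ 2) * v ^ (1 - 4 * s) := by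
  have hb := integrable_one_add_sq_mul_norm_sq (𝓕 b : 𝓢(ℝ, ℂ))
  have hsub := integral_packet_subst (fun ω => (1 + ω ^ 2) * ‖(𝓕 b : 𝓢(ℝ, ℂ)) ω‖ ^ 2) hv
  have hbI : Integrable fun w => (1 + (v * (w - (v ^ 2)⁻¹)) ^ 2) *
      ‖(𝓕 b : 𝓢(ℝ, ℂ)) (v * (w - (v ^ 2)⁻¹))‖ ^ 2 :=
    (hb.comp_mul_left' hv.ne').comp_sub_right ((v ^ 2)⁻¹)
  have hpt : ∀ w, ‖(((1 + w ^ 2) ^ (s / 2) : ℝ) : ℂ) * (𝓕 F : 𝓢(ℝ, ℂ)) w‖ ^ 2 ≤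
      (3 * v ^ (2 - 4 * s)) * ((1 + (v * (w - (v ^ 2)⁻¹)) ^ 2) *
      ‖(𝓕 b : 𝓢(ℝ, ℂ)) (v * (w - (v ^ 2)⁻¹))‖ ^ 2) := by
    intro w
    set ω := v * (w - (v ^ 2)⁻¹) with hω
    have h1 : ((1 + w ^ 2) ^ (s / 2)) ^ 2 = (1 + w ^ 2) ^ s := by
      rw [← Real.rpow_natCast, ← Real.rpow_mul (by positivity)]
      congr 1; push_cast; ring
    have h2 : (1 + w ^ 2) ^ s ≤ 3 * (1 + ω ^ 2) * v ^ (-(4 * s)) := by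
      calc (1 + w ^ 2) ^ s ≤ (3 * (1 + ω ^ 2) / v ^ 4) ^ s :=
            Real.rpow_le_rpow (by positivity) (frequency_sq_le hv hv1 w) hs
        _ = (3 * (1 + ω ^ 2)) ^ s * v ^ (-(4 * s)) := by
            rw [div_eq_mul_inv, Real.mul_rpow (by positivity) (by positivity)]
            congr 1
            rw [← Real.rpow_natCast, ← Real.rpow_neg hv.le, ← Real.rpow_mul hv.le]
            congr 1; push_cast; ring
        _ ≤ _ := by
            gcongr
            calc (3 * (1 + ω ^ 2)) ^ s ≤ (3 * (1 + ω ^ 2)) ^ (1 : ℝ) :=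
                  Real.rpow_le_rpow_of_exponent_le (by nlinarith [sq_nonneg ω]) hs1
              _ = _ := Real.rpow_one _
    rw [hF.fourier_apply hv, norm_mul, norm_mul, Complex.norm_real, Complex.norm_real,
      Real.norm_eq_abs, Real.norm_eq_abs, abs_of_pos hv, abs_of_nonneg (by positivity), mul_pow,
      mul_pow, h1]
    calc (1 + w ^ 2) ^ s * (v ^ 2 * ‖(𝓕 b : 𝓢(ℝ, ℂ)) ω‖ ^ 2)
        ≤ 3 * (1 + ω ^ 2) * v ^ (-(4 * s)) * (v ^ 2 * ‖(𝓕 b : 𝓢(ℝ, ℂ)) ω‖ ^ 2) := by gcongr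
      _ = _ := by
        have e : v ^ (2 - 4 * s) = v ^ (-(4 * s)) * v ^ 2 := by
          rw [← Real.rpow_natCast v 2, ← Real.rpow_add hv]
          congr 1; push_cast; ring
        rw [e]; ring
  calc _ ≤ ∫ w, (3 * v ^ (2 - 4 * s)) * ((1 + (v * (w - (v ^ 2)⁻¹)) ^ 2) *
        ‖(𝓕 b : 𝓢(ℝ, ℂ)) (v * (w - (v ^ 2)⁻¹))‖ ^ 2) :=
        integral_mono_of_nonneg (Eventually.of_forall fun w => by positivity)
          (hbI.const_mul _) (Eventually.of_forall hpt)
    _ = _ := by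
        rw [integral_const_mul, hsub, smul_eq_mul]
        have e : v ^ (2 - 4 * s) = v ^ (1 - 4 * s) * v := by
          nth_rw 3 [← Real.rpow_one v]
          rw [← Real.rpow_add hv]
          congr 1; ring
        rw [e]
        field_simp

end IsPacket

/-! ### Series of Schwartz functions in H^s -/

lemma norm_toLp_two_sq (G : 𝓢(ℝ, ℂ)) :
    ‖(G.toLp 2 : Lp ℂ 2 (volume : Measure ℝ))‖ ^ 2 = ∫ w, ‖G w‖ ^ 2 := by
  have h : eLpNorm (G.toLp 2 : Lp ℂ 2 (volume : Measure ℝ)) 2 volume = eLpNorm G 2 volume :=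
    eLpNorm_congr_ae (SchwartzMap.coeFn_toLp _ _ _)
  rw [Lp.norm_def, h, eLpNorm_two_eq_sqrt (G.memLp 2 volume), ENNReal.toReal_ofReal (by positivity),
    Real.sq_sqrt (integral_nonneg fun w => by positivity)]

lemma norm_toLp_two_fourier (G : 𝓢(ℝ, ℂ)) :
    ‖(G.toLp 2 : Lp ℂ 2 (volume : Measure ℝ))‖ =
      ‖((𝓕 G : 𝓢(ℝ, ℂ)).toLp 2 : Lp ℂ 2 (volume : Measure ℝ))‖ := by
  rw [← SchwartzMap.toLp_fourier_eq, Lp.norm_fourier_eq]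

/-- The Bessel potential of order `s` of a Schwartz function. -/
noncomputable def besselSchwartz (s : ℝ) (F : 𝓢(ℝ, ℂ)) : 𝓢(ℝ, ℂ) :=
  SchwartzMap.fourierMultiplierCLM ℂ (fun x : ℝ => (((1 + ‖x‖ ^ 2) ^ (s / 2) : ℝ) : ℂ)) F

lemma norm_besselSchwartz_toLp_sq (s : ℝ) (F : 𝓢(ℝ, ℂ)) :
    ‖((besselSchwartz s F).toLp 2 : Lp ℂ 2 (volume : Measure ℝ))‖ ^ 2 =
      ∫ w, ‖(((1 + w ^ 2) ^ (s / 2) : ℝ) : ℂ) * (𝓕 F : 𝓢(ℝ, ℂ)) w‖ ^ 2 := by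
  rw [norm_toLp_two_fourier, norm_toLp_two_sq, besselSchwartz,
    SchwartzMap.fourierMultiplierCLM_apply, FourierTransform.fourier_fourierInv_eq]
  refine integral_congr_ae (Eventually.of_forall fun w => ?_)
  simp only
  rw [SchwartzMap.smulLeftCLM_apply_apply (by fun_prop)]
  simp only [Real.norm_eq_abs, sq_abs, smul_eq_mul]

lemma besselPotential_toLp (s : ℝ) (F : 𝓢(ℝ, ℂ)) :
    TemperedDistribution.besselPotential ℝ ℂ s
        ((F.toLp 2 : Lp ℂ 2 (volume : Measure ℝ)) : 𝓢'(ℝ, ℂ)) =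
      (((besselSchwartz s F).toLp 2 : Lp ℂ 2 (volume : Measure ℝ)) : 𝓢'(ℝ, ℂ)) := by
  rw [TemperedDistribution.besselPotential, Lp.toTemperedDistribution_toLp_eq,
    Lp.toTemperedDistribution_toLp_eq,
    TemperedDistribution.fourierMultiplierCLM_toTemperedDistributionCLM_eq (by fun_prop)]
  rfl

/-- A series of Schwartz functions that converges absolutely in `H^s` has its sum in `H^s`. -/
lemma memHs_of_hasSum {s : ℝ} {F : ℕ → 𝓢(ℝ, ℂ)} {f : Lp ℂ 2 (volume : Measure ℝ)}
    (hf : HasSum (fun j => (F j).toLp 2) f)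
    (hs : Summable fun j => ‖((besselSchwartz s (F j)).toLp 2 : Lp ℂ 2 (volume : Measure ℝ))‖) :
    MemHs s f := by
  obtain ⟨u, hu⟩ := hs.of_norm
  refine ⟨u, ?_⟩
  have h1 := ((TemperedDistribution.besselPotential ℝ ℂ s).hasSum
    ((Lp.toTemperedDistributionCLM ℂ (volume : Measure ℝ) 2).hasSum hf))
  have h2 := (Lp.toTemperedDistributionCLM ℂ (volume : Measure ℝ) 2).hasSum hu
  simp only [Lp.toTemperedDistributionCLM_apply, besselPotential_toLp] at h1 h2
  exact h1.unique h2

/-- For fixed R, t, x the partial integral is the inner product of the transform with an L² function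
supported in the window, so it is continuous on L² and passes through the series. -/
lemma hasSum_boussinesqPartial {f : Lp ℂ 2 (volume : Measure ℝ)}
    {φ : ℕ → Lp ℂ 2 (volume : Measure ℝ)} (hf : HasSum φ f) {R : ℝ} (hR : 0 ≤ R) (t x : ℝ) :
    HasSum (fun j => boussinesqPartial (φ j) R t x) (boussinesqPartial f R t x) := by
  set r := R / (2 * Real.pi) with hr
  have hr0 : -r ≤ r := by
    have : 0 ≤ r := by positivity
    linarith
  set m : ℝ → ℂ := fun w => cis (-(2 * Real.pi * (x * w) + t * disp (2 * Real.pi * w))) with hm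
  have hmem : MemLp ((Ioc (-r) r).indicator m) 2 := by
    rw [memLp_indicator_iff_restrict measurableSet_Ioc]
    refine MemLp.of_bound (Continuous.aestronglyMeasurable (by fun_prop)) 1
      (Eventually.of_forall fun w => by simp [hm])
  have key : ∀ g : Lp ℂ 2 (volume : Measure ℝ), boussinesqPartial g R t x =
      innerSL ℂ (hmem.toLp _) (𝓕 g : Lp ℂ 2 (volume : Measure ℝ)) := by
    intro g
    rw [boussinesqPartial_eq_fourier, innerSL_apply_apply, L2.inner_def,
      intervalIntegral.integral_of_le hr0, ← integral_indicator measurableSet_Ioc]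
    refine integral_congr_ae ?_
    filter_upwards [hmem.coeFn_toLp] with w hw
    rw [hw]
    simp only [indicator]
    split_ifs
    · simp [hm, conj_cis, mul_comm]
    · simp
  simp only [key]
  exact (innerSL ℂ (hmem.toLp _)).hasSum
    ((Lp.fourierTransformₗᵢ ℝ ℂ).toContinuousLinearEquiv.hasSum'.2 hf)

lemma ae_eq_zero_of_hasSum {f : Lp ℂ 2 (volume : Measure ℝ)}
    {φ : ℕ → Lp ℂ 2 (volume : Measure ℝ)} (hf : HasSum φ f) {S : Set ℝ} (hS : MeasurableSet S)
    (h : ∀ j, ∀ᵐ x, x ∈ S → φ j x = 0) : ∀ᵐ x, x ∈ S → f x = 0 := by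
  have h0 : ∀ j, LpToLpRestrictCLM ℝ ℂ ℂ volume 2 S (φ j) = 0 := by
    intro j
    rw [Lp.eq_zero_iff_ae_eq_zero]
    filter_upwards [LpToLpRestrictCLM_coeFn ℂ S (φ j), (ae_restrict_iff' hS).2 (h j)] with x h1 h2
    rw [h1, h2]; rfl
  have h1 := (LpToLpRestrictCLM ℝ ℂ ℂ volume 2 S).hasSum hf
  simp only [h0] at h1
  have h2 := h1.unique hasSum_zero
  rw [← ae_restrict_iff' hS]
  filter_upwards [LpToLpRestrictCLM_coeFn ℂ S f, (Lp.eq_zero_iff_ae_eq_zero).1 h2] with x h3 h4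
  rw [← h3, h4]; rfl

/-- The evolution of a series of Schwartz functions, under a uniform summable bound of the partial
integrals. -/
lemma tendsto_boussinesqPartial_of_hasSum {F : ℕ → 𝓢(ℝ, ℂ)} {f : Lp ℂ 2 (volume : Measure ℝ)}
    (hf : HasSum (fun j => (F j).toLp 2) f) {t x : ℝ} {B : ℕ → ℝ} (hB : Summable B)
    (hle : ∀ j R, 0 ≤ R → ‖boussinesqPartial ((F j).toLp 2) R t x‖ ≤ B j) :
    Tendsto (fun R => boussinesqPartial f R t x) atTop (𝓝 (∑' j, evolution (F j) t x)) := by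
  have hev : ∀ᶠ R : ℝ in atTop, ∀ j, ‖boussinesqPartial ((F j).toLp 2) R t x‖ ≤ B j := by
    filter_upwards [eventually_ge_atTop 0] with R hR j using hle j R hR
  have hlim : ∀ j, Tendsto (fun R => boussinesqPartial ((F j).toLp 2) R t x) atTop
      (𝓝 (evolution (F j) t x)) := fun j => tendsto_boussinesqPartial_toLp (F j) t x
  have h : Tendsto (fun R => ∑' j, boussinesqPartial ((F j).toLp 2) R t x) atTop
      (𝓝 (∑' j, evolution (F j) t x)) :=
    tendsto_tsum_of_dominated_convergence hB hlim hev
  refine h.congr' ?_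
  filter_upwards [eventually_ge_atTop 0] with R hR
  exact (hasSum_boussinesqPartial hf hR t x).tsum_eq

lemma exists_schwartz_bump : ∃ b : 𝓢(ℝ, ℂ), HasCompactSupport b ∧ b 0 = 1 ∧
    ∀ y, 2 < |y| → b y = 0 := by
  let β : ContDiffBump (0 : ℝ) := ⟨1, 2, one_pos, one_lt_two⟩
  have hc : HasCompactSupport fun x => (β x : ℂ) :=
    β.hasCompactSupport.comp_left (g := fun x : ℝ => (x : ℂ)) rfl
  have hs : ContDiff ℝ (⊤ : ℕ∞) fun x => (β x : ℂ) := Complex.ofRealCLM.contDiff.comp β.contDiff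
  refine ⟨hc.toSchwartzMap hs, hc, ?_, fun y hy => ?_⟩
  · show ((β 0 : ℝ) : ℂ) = 1
    rw [β.one_of_mem_closedBall (by simp [β])]; simp
  · show ((β y : ℝ) : ℂ) = 0
    rw [β.zero_of_le_dist (by simpa [β] using hy.le)]; simp

/-! ### Widths and arrival times -/

/-- The superexponentially decreasing widths of the wave packets. -/
noncomputable def width (ε : ℝ) (j : ℕ) : ℝ := ε ^ 4 ^ j

section Width

variable {ε : ℝ}

lemma width_pos (h : 0 < ε) (j : ℕ) : 0 < width ε j := pow_pos h _

lemma width_succ (ε : ℝ) (j : ℕ) : width ε (j + 1) = width ε j ^ 4 := by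
  rw [width, width, pow_succ, pow_mul]

/-- Far from sharp: the factor 2 in the exponent leaves room to split one power into decay in both
packet indices. -/
lemma width_le (h : 0 < ε) (h1 : ε ≤ 1 / 2) (j : ℕ) : width ε j ≤ (1 / 2) ^ (2 * j + 1) := by
  induction j with
  | zero => simpa [width] using h1
  | succ j ih =>
    rw [width_succ]
    calc width ε j ^ 4 ≤ ((1 / 2 : ℝ) ^ (2 * j + 1)) ^ 4 :=
          pow_le_pow_left₀ (width_pos h j).le ih 4
      _ = (1 / 2) ^ (8 * j + 4) := by rw [← pow_mul]; congr 1; ring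
      _ ≤ _ := pow_le_pow_of_le_one (by norm_num) (by norm_num) (by omega)

lemma width_le_self (h : 0 < ε) (h1 : ε ≤ 1 / 2) (j : ℕ) : width ε j ≤ ε :=
  pow_le_of_le_one h.le (by linarith) (by positivity)

lemma width_antitone (h : 0 < ε) (h1 : ε ≤ 1 / 2) : Antitone (width ε) := fun i j hij =>
  pow_le_pow_of_le_one h.le (by linarith) (Nat.pow_le_pow_right (by norm_num) hij)

lemma width_le_geometric (h : 0 < ε) (h1 : ε ≤ 1 / 2) (j : ℕ) : width ε j ≤ (1 / 2) ^ j :=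
  (width_le h h1 j).trans (pow_le_pow_of_le_one (by norm_num) (by norm_num) (by omega))

/-- This ratio measures a wider packet j at the arrival time of packet k: the time is at most v_k²
and the rate of change is of order v_j⁻⁴. The rule v_{j+1} = v_j⁴ is made for it. -/
lemma width_sq_div_le (h : 0 < ε) (h1 : ε ≤ 1 / 2) {j k : ℕ} (hjk : j < k) :
    width ε k ^ 2 / width ε j ^ 4 ≤ (1 / 2) ^ k * (1 / 2) ^ j := by
  have hk := width_pos h k
  have hj := width_pos h j
  have h2 : width ε k ≤ width ε j ^ 4 := by
    rw [← width_succ]; exact width_antitone h h1 hjk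
  calc width ε k ^ 2 / width ε j ^ 4 ≤ width ε k := by
        rw [div_le_iff₀ (by positivity), sq]; gcongr
    _ ≤ (1 / 2) ^ (2 * k + 1) := width_le h h1 k
    _ ≤ (1 / 2) ^ (k + j) := pow_le_pow_of_le_one (by norm_num) (by norm_num) (by omega)
    _ = _ := pow_add _ _ _

/-- This ratio measures a narrower packet j at the arrival time of packet k: the dispersive factor
is of order 1/v_k and the L¹ norm of order v_j. -/
lemma width_div_le (h : 0 < ε) (h1 : ε ≤ 1 / 2) {j k : ℕ} (hkj : k < j) :
    width ε j / width ε k ≤ (1 / 2) ^ k * (1 / 2) ^ j := by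
  obtain ⟨i, rfl⟩ : ∃ i, j = i + 1 := ⟨j - 1, by omega⟩
  have hk := width_pos h k
  have hi := width_pos h i
  have hik : width ε i ≤ width ε k := width_antitone h h1 (by omega)
  have hi1 : width ε i ≤ 1 := (width_le_self h h1 i).trans (by linarith)
  calc width ε (i + 1) / width ε k ≤ width ε i := by
        rw [div_le_iff₀ hk, width_succ]
        calc width ε i ^ 4 ≤ width ε i ^ 2 := pow_le_pow_of_le_one hi.le hi1 (by norm_num)
          _ = width ε i * width ε i := sq _
          _ ≤ _ := by gcongr
    _ ≤ (1 / 2) ^ (2 * i + 1) := width_le h h1 i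
    _ ≤ (1 / 2) ^ (k + (i + 1)) := pow_le_pow_of_le_one (by norm_num) (by norm_num) (by omega)
    _ = _ := pow_add _ _ _

lemma summable_width_rpow (h : 0 < ε) (h1 : ε ≤ 1 / 2) {a : ℝ} (ha : 0 < a) :
    Summable fun j => width ε j ^ a := by
  have hr : (1 / 2 : ℝ) ^ a < 1 := Real.rpow_lt_one (by norm_num) (by norm_num) ha
  refine Summable.of_nonneg_of_le (fun j => Real.rpow_nonneg (width_pos h j).le a) (fun j => ?_)
    (summable_geometric_of_lt_one (by positivity) hr)
  calc width ε j ^ a ≤ ((1 / 2 : ℝ) ^ j) ^ a :=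
        Real.rpow_le_rpow (width_pos h j).le (width_le_geometric h h1 j) ha.le
    _ = _ := by
        rw [← Real.rpow_natCast, ← Real.rpow_mul (by norm_num), mul_comm,
          Real.rpow_mul (by norm_num), Real.rpow_natCast]

end Width

/-- The group velocity ω'(ξ₀) lies between ξ₀ and 3ξ₀, so the arrival time is comparable to v². The
upper bound controls wider packets, the lower one narrower packets. -/
lemma arrivalTime_bounds {x δ v : ℝ} (hδ : 0 < δ) (hxδ : δ ≤ |x|) (hx2 : |x| ≤ 2) (hv : 0 < v)
    (hv1 : v ≤ 1) :
    0 < |x| / dispOdd' (2 * Real.pi / v ^ 2) ∧ |x| / dispOdd' (2 * Real.pi / v ^ 2) ≤ v ^ 2 ∧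
      √(δ / (6 * Real.pi)) * v ≤ √(|x| / dispOdd' (2 * Real.pi / v ^ 2)) := by
  set ξ₀ := 2 * Real.pi / v ^ 2 with hξ₀
  have hv2 : v ^ 2 ≤ 1 := pow_le_one₀ hv.le hv1
  have hpi := Real.pi_gt_three
  have hξ1 : 1 ≤ ξ₀ := by rw [hξ₀, le_div_iff₀ (by positivity)]; nlinarith
  have hd : ξ₀ ≤ dispOdd' ξ₀ := le_dispOdd' (by linarith)
  have hd3 : dispOdd' ξ₀ ≤ 3 * ξ₀ := dispOdd'_le hξ1
  have hdpos : 0 < dispOdd' ξ₀ := by linarith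
  refine ⟨div_pos (hδ.trans_le hxδ) hdpos, ?_, ?_⟩
  · rw [div_le_iff₀ hdpos]
    have e : v ^ 2 * ξ₀ = 2 * Real.pi := by rw [hξ₀]; field_simp
    have := mul_le_mul_of_nonneg_left hd (sq_nonneg v)
    linarith
  · rw [← Real.sqrt_sq hv.le, ← Real.sqrt_mul (by positivity)]
    apply Real.sqrt_le_sqrt
    calc δ / (6 * Real.pi) * v ^ 2 = δ / (3 * ξ₀) := by rw [hξ₀]; field_simp; norm_num
      _ ≤ |x| / dispOdd' ξ₀ := by gcongr

/-! ### The counterexample and the conclusion -/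

/-- Below the critical index there is a compactly supported function whose evolution does not
converge at any point of an interval away from the support. -/
theorem exists_not_tendsto_boussinesq {s : ℝ} (hs0 : 0 < s) (hs : s < 1 / 4) :
    ∃ a b c d : ℝ, a < b ∧ c < d ∧ Disjoint (Icc a b) (Icc c d) ∧
      ∃ f₀ : Lp ℂ 2 (volume : Measure ℝ), MemHs s f₀ ∧
        (∀ᵐ x : ℝ, x ∉ Icc a b → f₀ x = 0) ∧
        ∀ x ∈ Icc c d, (∀ t : ℝ, BoussinesqExists f₀ t x) ∧
          ¬ Tendsto (fun t : ℝ => boussinesq f₀ t x) (𝓝[>] 0) (𝓝 0) := by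
  obtain ⟨b, hbc, hb0, hbsupp⟩ := exists_schwartz_bump
  set M₁ := ∫ y, ‖b y‖ with hM₁
  set M₂ := ∫ ω, (1 + ω ^ 2) * ‖(𝓕 b : 𝓢(ℝ, ℂ)) ω‖ with hM₂
  set M₃ := ∫ ω, (1 + ω ^ 2) * ‖(𝓕 b : 𝓢(ℝ, ℂ)) ω‖ ^ 2 with hM₃
  have hM₁0 : 0 ≤ M₁ := integral_nonneg fun _ => norm_nonneg _
  have hM₂0 : 0 ≤ M₂ := integral_nonneg fun _ => by positivity
  have hpi := Real.pi_gt_three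
  -- For |x| ≤ 2δ dispersion costs an arriving packet at most half of its size.
  obtain ⟨δ, hδ, hδ1, hδM⟩ : ∃ δ : ℝ, 0 < δ ∧ δ ≤ 1 ∧ 14 * Real.pi * (2 * δ) * M₂ ≤ 1 / 2 := by
    refine ⟨1 / (56 * Real.pi * (M₂ + 1)), by positivity, ?_, ?_⟩
    · rw [div_le_one (by positivity)]; nlinarith
    · have e : 14 * Real.pi * (2 * (1 / (56 * Real.pi * (M₂ + 1)))) * M₂ =
          1 / 2 * (M₂ / (M₂ + 1)) := by field_simp; norm_num
      rw [e]
      have : M₂ / (M₂ + 1) ≤ 1 := by rw [div_le_one (by positivity)]; linarith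
      linarith
  -- The profile vanishes outside [-2, 2], so widths at most ε keep all packets inside [-δ/2, δ/2].
  obtain ⟨ε, hε, hε1, hεδ⟩ : ∃ ε : ℝ, 0 < ε ∧ ε ≤ 1 / 2 ∧ 2 * ε ≤ δ / 2 :=
    ⟨δ / 4, by positivity, by linarith, by linarith⟩
  set v := width ε with hv
  have hv0 : ∀ j, 0 < v j := width_pos hε
  have hvε : ∀ j, v j ≤ ε := width_le_self hε hε1
  have hv1 : ∀ j, v j ≤ 1 := fun j => (hvε j).trans (by linarith)
  choose F hF using fun j => exists_isPacket hbc (hv0 j)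
  have hsupp : ∀ j x, δ / 2 < |x| → F j x = 0 := fun j x hx =>
    (hF j).eq_zero_of_lt_abs (hv0 j) hbsupp (by linarith [hvε j])
  -- summability in Sobolev spaces
  have hbessel : ∀ r, 0 ≤ r → r < 1 / 4 → Summable fun j =>
      ‖((besselSchwartz r (F j)).toLp 2 : Lp ℂ 2 (volume : Measure ℝ))‖ := by
    intro r hr0 hr
    refine Summable.of_nonneg_of_le (fun j => norm_nonneg _) (fun j => ?_)
      ((summable_width_rpow hε hε1 (a := (1 - 4 * r) / 2) (by linarith)).mul_left √(3 * M₃))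
    have h1 := (hF j).integral_weighted_sq_le (hv0 j) (hv1 j) hr0 (by linarith)
    rw [← norm_besselSchwartz_toLp_sq] at h1
    have h2 := Real.le_sqrt_of_sq_le h1
    refine h2.trans (le_of_eq ?_)
    rw [Real.sqrt_mul' _ (Real.rpow_nonneg (hv0 j).le _), Real.sqrt_eq_rpow (v j ^ _),
      ← Real.rpow_mul (hv0 j).le]
    congr 2; ring
  have hsum : Summable fun j => ((F j).toLp 2 : Lp ℂ 2 (volume : Measure ℝ)) := by
    refine Summable.of_norm ((hbessel 0 le_rfl (by norm_num)).congr fun j => ?_)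
    refine (sq_eq_sq₀ (norm_nonneg _) (norm_nonneg _)).1 ?_
    rw [norm_besselSchwartz_toLp_sq, norm_toLp_two_fourier (F j), norm_toLp_two_sq]
    simp
  obtain ⟨f₀, hf₀⟩ := hsum
  -- The second interval lies on the negative side because the phase xξ + tω(ξ) moves positive
  -- frequencies to the left.
  refine ⟨-(δ / 2), δ / 2, -(2 * δ), -δ, by linarith, by linarith, ?_, f₀,
    memHs_of_hasSum hf₀ (hbessel s hs0.le hs), ?_, fun x hx => ?_⟩
  · rw [Set.disjoint_left]
    rintro x ⟨hx1, _⟩ ⟨_, hx2⟩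
    linarith
  · refine ae_eq_zero_of_hasSum hf₀ (S := (Icc (-(δ / 2)) (δ / 2))ᶜ) measurableSet_Icc.compl
      fun j => ?_
    filter_upwards [SchwartzMap.coeFn_toLp (F j) 2 volume] with x hx hxS
    rw [hx]
    refine hsupp j x ?_
    by_contra! h
    exact hxS (abs_le.1 h)
  have hxneg : x ≤ 0 := by linarith [hx.2]
  have habs : |x| = -x := abs_of_nonpos hxneg
  have hxδ : δ ≤ |x| := by linarith [hx.2]
  have hx2δ : |x| ≤ 2 * δ := by linarith [hx.1]
  have hFx : ∀ j, F j x = 0 := fun j => hsupp j x (by linarith)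
  have hpart_ne : ∀ t, t ≠ 0 → ∀ j R, 0 ≤ R →
      ‖boussinesqPartial ((F j).toLp 2) R t x‖ ≤ (2 + 24 / √|t|) * (v j * M₁) := by
    intro t ht j R hR
    rw [hM₁, ← (hF j).integral_norm (hv0 j)]
    exact norm_boussinesqPartial_toLp_le (F j) hR fun y _ => norm_integral_symm_dispersive_le hR ht
  have hpart_zero : ∀ j R, 0 ≤ R →
      ‖boussinesqPartial ((F j).toLp 2) R 0 x‖ ≤ (4 / δ) * (v j * M₁) := by
    intro j R hR
    rw [hM₁, ← (hF j).integral_norm (hv0 j)]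
    refine norm_boussinesqPartial_toLp_le (F j) hR fun y hy => ?_
    have hy' : |y| ≤ δ / 2 := by
      by_contra! h; exact hy (hsupp j y h)
    have hxy : δ / 2 ≤ |x - y| := by
      have := abs_sub_abs_le_abs_sub x y
      linarith
    have hne : x - y ≠ 0 := fun h => by rw [h, abs_zero] at hxy; linarith
    simp only [zero_mul, add_zero]
    refine (norm_integral_symm_cis_le hne).trans ?_
    calc 2 / |x - y| ≤ 2 / (δ / 2) := by gcongr
      _ = 4 / δ := by field_simp; norm_num
  have hvsum : Summable v := by
    simpa using summable_width_rpow hε hε1 one_pos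
  have hlim : ∀ t, Tendsto (fun R => boussinesqPartial f₀ R t x) atTop
      (𝓝 (∑' j, evolution (F j) t x)) := by
    intro t
    rcases eq_or_ne t 0 with rfl | ht
    · exact tendsto_boussinesqPartial_of_hasSum hf₀ ((hvsum.mul_right M₁).mul_left _) hpart_zero
    · exact tendsto_boussinesqPartial_of_hasSum hf₀ ((hvsum.mul_right M₁).mul_left _)
        (hpart_ne t ht)
  refine ⟨fun t => ⟨_, hlim t⟩, fun hcon => ?_⟩
  have hev_le : ∀ t, t ≠ 0 → ∀ j, ‖evolution (F j) t x‖ ≤ (2 + 24 / √|t|) * (v j * M₁) := by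
    intro t ht j
    refine le_of_tendsto (tendsto_boussinesqPartial_toLp (F j) t x).norm ?_
    filter_upwards [eventually_ge_atTop 0] with R hR using hpart_ne t ht j R hR
  set τ : ℕ → ℝ := fun k => |x| / dispOdd' (2 * Real.pi / v k ^ 2) with hτ
  have hτb := fun k => arrivalTime_bounds (v := v k) hδ hxδ (by linarith) (hv0 k) (hv1 k)
  set κ := √(δ / (6 * Real.pi)) with hκ
  have hκ0 : 0 < κ := Real.sqrt_pos.2 (by positivity)
  set D := (2 + 24 / κ) * M₁ + 294 * M₂ with hD
  have herr : ∀ k j, j ≠ k → ‖evolution (F j) (τ k) x‖ ≤ D * (1 / 2) ^ k * (1 / 2) ^ j := by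
    intro k j hjk
    obtain ⟨hτ0, hτ1, hτ2⟩ := hτb k
    change 0 < τ k at hτ0
    change τ k ≤ _ at hτ1
    change κ * v k ≤ √(τ k) at hτ2
    have hvk := hv0 k
    have hvj := hv0 j
    -- Packets with j < k are wider and have hardly moved from their support; those with j > k are
    -- narrower and small by dispersion.
    rcases lt_or_gt_of_ne hjk with h | h
    · have h1 := (hF j).norm_evolution_le_of_eq_zero (hv0 j) (hv1 j) (t := τ k) (hFx j)
      rw [abs_of_pos hτ0] at h1
      calc _ ≤ _ := h1
        _ ≤ v k ^ 2 * (294 * M₂ / v j ^ 4) := by gcongr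
        _ = 294 * M₂ * (v k ^ 2 / v j ^ 4) := by ring
        _ ≤ 294 * M₂ * ((1 / 2) ^ k * (1 / 2) ^ j) := by
            gcongr; exact width_sq_div_le hε hε1 h
        _ ≤ D * ((1 / 2) ^ k * (1 / 2) ^ j) := by
            gcongr
            have : 0 ≤ (2 + 24 / κ) * M₁ := by positivity
            linarith
        _ = _ := by ring
    · have h1 := hev_le (τ k) hτ0.ne' j
      rw [abs_of_pos hτ0] at h1
      have h2 : 2 + 24 / √(τ k) ≤ (2 + 24 / κ) / v k := by
        have h3 : 24 / √(τ k) ≤ 24 / (κ * v k) := by gcongr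
        have h4 : 2 ≤ 2 / v k := by
          rw [le_div_iff₀ hvk]; linarith [hv1 k]
        calc _ ≤ 2 / v k + 24 / (κ * v k) := add_le_add h4 h3
          _ = _ := by field_simp
      calc _ ≤ _ := h1
        _ ≤ (2 + 24 / κ) / v k * (v j * M₁) := by gcongr
        _ = (2 + 24 / κ) * M₁ * (v j / v k) := by ring
        _ ≤ (2 + 24 / κ) * M₁ * ((1 / 2) ^ k * (1 / 2) ^ j) := by
            gcongr; exact width_div_le hε hε1 h
        _ ≤ D * ((1 / 2) ^ k * (1 / 2) ^ j) := by
            gcongr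
            have : 0 ≤ 294 * M₂ := by positivity
            linarith
        _ = _ := by ring
  have hlower : ∀ k, 1 / 2 - D * (1 / 2) ^ k * 2 ≤ ‖boussinesq f₀ (τ k) x‖ := by
    intro k
    have hb : boussinesq f₀ (τ k) x = ∑' j, evolution (F j) (τ k) x := (hlim (τ k)).limUnder_eq
    have hsm : Summable fun j => evolution (F j) (τ k) x :=
      Summable.of_norm_bounded ((hvsum.mul_right M₁).mul_left _) (hev_le (τ k) (hτb k).1.ne')
    rw [hb, hsm.tsum_eq_add_tsum_ite k]
    have h1 := tsum_of_norm_bounded (f := fun j => if j = k then 0 else evolution (F j) (τ k) x)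
      (hasSum_geometric_two.mul_left (D * (1 / 2) ^ k)) (fun j => by
        split_ifs with h
        · rw [norm_zero]; positivity
        · exact herr k j h)
    have h2 := (hF k).one_sub_le_norm_evolution hb0 (hv0 k) (hv1 k) hxneg
    have h3 : 14 * Real.pi * |x| * M₂ ≤ 1 / 2 := le_trans (by gcongr) hδM
    have h4 := norm_sub_le_norm_add (evolution (F k) (τ k) x)
      (∑' j, if j = k then 0 else evolution (F j) (τ k) x)
    change 1 - _ ≤ ‖evolution (F k) (τ k) x‖ at h2
    linarith
  have hτlim : Tendsto τ atTop (𝓝[>] 0) := by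
    rw [tendsto_nhdsWithin_iff]
    refine ⟨?_, Eventually.of_forall fun k => (hτb k).1⟩
    refine squeeze_zero (fun k => (hτb k).1.le) (fun k => ?_)
      (tendsto_pow_atTop_nhds_zero_of_lt_one (r := (1 / 2 : ℝ)) (by norm_num) (by norm_num))
    refine (hτb k).2.1.trans ((pow_le_of_le_one (hv0 k).le (hv1 k) two_ne_zero).trans ?_)
    exact width_le_geometric hε hε1 k
  have hz := (hcon.comp hτlim).norm
  have hDlim : Tendsto (fun k : ℕ => 1 / 2 - D * (1 / 2 : ℝ) ^ k * 2) atTop (𝓝 (1 / 2)) := by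
    have := ((tendsto_pow_atTop_nhds_zero_of_lt_one (r := (1 / 2 : ℝ)) (by norm_num)
      (by norm_num)).const_mul D).mul_const 2
    simpa only [mul_zero, zero_mul, sub_zero] using this.const_sub (1 / 2)
  have hfin := le_of_tendsto_of_tendsto' hDlim hz hlower
  rw [norm_zero] at hfin
  linarith

theorem theorem1p1 :
    -- the optimal order is `1/4`
    IsLeast {σ : ℝ | 0 ≤ σ ∧ ∀ s : ℝ, σ ≤ s → ∀ f : Lp ℂ 2 (volume : Measure ℝ),
      MemHs s f → BoussinesqConvergesAE f} (1 / 4) ∧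
    -- (i)
    (∀ s : ℝ, 1 / 4 ≤ s → ∀ f : Lp ℂ 2 (volume : Measure ℝ),
      MemHs s f → BoussinesqConvergesAE f) ∧
    -- (ii)
    (∀ s : ℝ, 0 < s → s < 1 / 4 →
      ∃ a b c d : ℝ, a < b ∧ c < d ∧ Disjoint (Icc a b) (Icc c d) ∧
        ∃ f₀ : Lp ℂ 2 (volume : Measure ℝ), MemHs s f₀ ∧
          (∀ᵐ x : ℝ, x ∉ Icc a b → f₀ x = 0) ∧
          ∀ x ∈ Icc c d, (∀ t : ℝ, BoussinesqExists f₀ t x) ∧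
            ¬ Tendsto (fun t : ℝ => boussinesq f₀ t x) (𝓝[>] 0) (𝓝 0)) := by
  refine ⟨⟨⟨by norm_num, fun s hs f hf => boussinesqConvergesAE_of_memHs hs hf⟩, ?_⟩,
    fun s hs f hf => boussinesqConvergesAE_of_memHs hs hf,
    fun s hs0 hs => exists_not_tendsto_boussinesq hs0 hs⟩
  rintro σ ⟨hσ0, hσ⟩
  by_contra! hlt
  -- The midpoint of σ and 1/4 is positive even when σ = 0. Since the counterexample vanishes almost
  -- everywhere on the second interval, convergence to it there would be convergence to 0, forcing
  -- an interval of positive length to be null.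
  obtain ⟨a, b, c, d, _, hcd, hdisj, f₀, hf₀, hzero, hJ⟩ :=
    exists_not_tendsto_boussinesq (s := (σ + 1 / 4) / 2) (by linarith) (by linarith)
  have hconv := hσ _ (by linarith) f₀ hf₀
  have hnull : ∀ᵐ x : ℝ, x ∉ Icc c d := by
    filter_upwards [hconv, hzero] with x hx hx0 hxJ
    refine (hJ x hxJ).2 ?_
    rw [← hx0 fun h => Set.disjoint_left.1 hdisj h hxJ]
    exact hx.2.mono_left (nhdsWithin_mono 0 fun t ht => ne_of_gt ht)
  have hvol : volume (Icc c d) = 0 := by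
    rw [ae_iff] at hnull
    simpa only [not_not, Set.ofPred_mem_eq] using hnull
  rw [Real.volume_Icc, ENNReal.ofReal_eq_zero] at hvol
  linarith
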